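/- **Setting.** Let $\alpha>-1/2$, $l,\tau>0$, $D=[0,l]\times[0,\tau]$, $r\in\mathbb Z^+$. Let $C_n^{(\alpha)}$ be the Gegenbauer polynomials standardized by $C_n^{(\alpha)}(1)=1$, i.e. $C_0^{(\alpha)}=1$, $C_1^{(\alpha)}=x$, $(n+2\alpha)C_{n+1}^{(\alpha)}=2(n+\alpha)xC_n^{(\alpha)}-nC_{n-1}^{(\alpha)}$ for $n\ge1$, and let $C_{L,n}^{(\alpha)}(x)=C_n^{(\alpha)}(2x/L-1)$, $\lambda_n^{(\alpha)}=\int_{-1}^1 (C_n^{(\alpha)}(x))^2(1-x^2)^{\alpha-1/2}dx$, $\lambda_{L,n}^{(\alpha)}=\int_0^L (C_{L,n}^{(\alpha)}(x))^2(Lx-x^2)^{\alpha-1/2}dx$. Let $x_{L,N,k}^{(\alpha)}$, $k=0,\dots,N$, be the zeros of $C_{L,N+1}^{(\alpha)}$ and let $\varpi_{L,N,k}^{(\alpha)}=(L/2)^{2\alpha}\varpi_{N,k}^{(\alpha)}$ be the corresponding Christoffel numbers, where $(\varpi_{N,k}^{(\alpha)})^{-1}=\sum_{j=0}^N(\lambda_j^{(\alpha)})^{-1}\bigl(C_{L,j}^{(\alpha)}(x_{L,N,k}^{(\alpha)})\bigr)^2$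 (this does not depend on $L$). Let $u$ be a solution of the telegraph problem $u_{tt}+\beta_1u_t+\beta_2u=u_{xx}+f$ for $0<x<l$, $0<t<\tau$, with $f$ integrable, $u(x,0)=g_1(x)$, $u_t(x,0)=g_2(x)$ for $0<x<l$, and $u(0,t)=h_1(t)$, $u(l,t)=h_2(t)$ for $0<t\le\tau$. Suppose that $u\in L^\infty(D)$ and that for each $t\in[0,\tau]$ the function $u(\cdot,t)$ is a polynomial of degree at most $r$ on $[0,l]$. For $0\le n\le N_x$, $0\le m\le N_t$ define the discrete coefficients of $u_{xx}$ $$\tilde\phi_{n,m}=\frac1{\lambda_{l,n}^{(\alpha)}\lambda_{\tau,m}^{(\alpha)}}\sum_{s=0}^{N_x}\sum_{k=0}^{N_t}\varpi_{l,N_x,s}^{(\alpha)}\,\varpi_{\tau,N_t,k}^{(\alpha)}\,u_{xx}(x_{l,N_x,s}^{(\alpha)},x_{\tau,N_t,k}^{(\alpha)})\,C_{l,n}^{(\alpha)}(x_{l,N_x,s}^{(\alpha)})\,C_{\tau,m}^{(\alpha)}(x_{\tau,N_t,k}^{(\alpha)}).$$ **Claim.** There is an absolute constant $C>0$ such that,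 with $C_l=4C/l^2$ and $\|u\|=\|u\|_{L^\infty(D)}$, always: 1. if $\alpha\ge0$: $\displaystyle|\tilde\phi_{n,m}|\le\frac{4C_lr^4(n+\alpha)(m+\alpha)\Gamma(n+2\alpha)\Gamma(m+2\alpha)}{\Gamma^2(2\alpha+1)\Gamma(n+1)\Gamma(m+1)}\|u\|$, where, if $\alpha=0$, the factor $(n+\alpha)\Gamma(n+2\alpha)$ at $n=0$ (and likewise for $m$) is read as its limit $1/2$ as $\alpha\to0^+$; 2. if $-\frac12<\alpha<0$ and $n,m$ are even: $\displaystyle|\tilde\phi_{n,m}|\le\frac{C_lr^4|(n+\alpha)(m+\alpha)|}{\alpha^2}\left|\binom{\frac n2+\alpha-1}{\frac n2}\binom{\frac m2+\alpha-1}{\frac m2}\right|\|u\|$; 3. if $-\frac12<\alpha<0$ and $n,m$ are odd: $\displaystyle|\tilde\phi_{n,m}|\le\frac{4C_lr^4|(n+\alpha)(m+\alpha)|\,\Gamma(\frac{n+1}2+\alpha)\Gamma(\frac{m+1}2+\alpha)}{\Gamma^2(\alpha+1)\Gamma(\frac{n+1}2)\Gamma(\frac{m+1}2)\sqrt[4]{n^2m^2(n+2\alpha)^2(m+2\alpha)^2}}\|u\|$;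 4. if $-\frac12<\alpha<0$, $n$ is even and $m$ is odd: $\displaystyle|\tilde\phi_{n,m}|\le\frac{2C_lr^4\,\Gamma(\frac{m+1}2+\alpha)|(n+\alpha)(m+\alpha)|}{\alpha^2\sqrt{m(m+2\alpha)}\,\Gamma(\frac{m+1}2)\,|\Gamma(\alpha)|}\left|\binom{\frac n2+\alpha-1}{\frac n2}\right|\|u\|$; 5. if $-\frac12<\alpha<0$, $n$ is odd and $m$ is even: the bound of item 4 with $n$ and $m$ interchanged. Moreover, let $D_1^{(\alpha)}=\dfrac{\pi^2\,2^{3-4\alpha}e^{-4\alpha-2}}{\Gamma^2(\alpha+\frac12)\Gamma^2(\alpha+1)}$. With the same $C$, for every $\alpha>-\frac12$ there are constants $A_1^{(\alpha)},A_2^{(\alpha)}>1$ and an integer $K$, depending only on $\alpha$, such that with $D_2^{(\alpha)}=A_1^{(\alpha)}A_2^{(\alpha)}D_1^{(\alpha)}$, $D_{1,l}^{(\alpha)}=C_lD_1^{(\alpha)}$, $D_{2,l}^{(\alpha)}=C_lD_2^{(\alpha)}$, for all $n,m\ge K$ (and all $N_x\ge n$, $N_t\ge m$, and all $l,\tau,r,u$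 as above) $$|\tilde\phi_{n,m}|\le D_{1,l}^{(\alpha)}r^4(nm)^{2\alpha}\|u\|\ \text{ if }\alpha\ge0,\qquad|\tilde\phi_{n,m}|\le D_{2,l}^{(\alpha)}r^4(nm)^{\alpha}\|u\|\ \text{ if }-\tfrac12<\alpha<0.$$ -/

import Mathlib

open Set MeasureTheory Polynomial
open scoped ENNReal

noncomputable section

/-- The Gegenbauer polynomials `C_n^{(α)}`, standardized by `C_n^{(α)}(1) = 1`:
`C_0 = 1`, `C_1 = x`, `(n + 2α) C_{n+1} = 2 (n + α) x C_n - n C_{n-1}` for `n ≥ 1`. -/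
def gegenbauer (α : ℝ) : ℕ → ℝ[X]
  | 0 => 1
  | 1 => X
  | n + 2 => C (1 / (((n + 1 : ℕ) : ℝ) + 2 * α)) *
      (C (2 * (((n + 1 : ℕ) : ℝ) + α)) * X * gegenbauer α (n + 1)
        - C ((n + 1 : ℕ) : ℝ) * gegenbauer α n)

/-- The shifted Gegenbauer polynomial `C_{L,n}^{(α)}(x) = C_n^{(α)}(2x/L - 1)` on `[0, L]`. -/
def shiftedGegenbauer (L α : ℝ) (n : ℕ) : ℝ[X] :=
  (gegenbauer α n).comp (C (2 / L) * X - 1)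

/-- `λ_n^{(α)} = ∫_{-1}^{1} C_n^{(α)}(x)² (1 - x²)^{α - 1/2} dx`. -/
def gegenbauerNormSq (α : ℝ) (n : ℕ) : ℝ :=
  ∫ x in (-1 : ℝ)..1, (gegenbauer α n).eval x ^ 2 * (1 - x ^ 2) ^ (α - 1 / 2)

/-- `λ_{L,n}^{(α)} = ∫_0^L C_{L,n}^{(α)}(x)² (L x - x²)^{α - 1/2} dx`. -/
def shiftedNormSq (L α : ℝ) (n : ℕ) : ℝ :=
  ∫ x in (0 : ℝ)..L, (shiftedGegenbauer L α n).eval x ^ 2 * (L * x - x ^ 2) ^ (α - 1 / 2)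

/-- The shifted Gegenbauer-Gauss nodes `x_{L,N,k}^{(α)}`, `k = 0, …, N`: the zeros of
`C_{L,N+1}^{(α)}`. -/
def sggNodes (L α : ℝ) (N : ℕ) : Finset ℝ :=
  (shiftedGegenbauer L α (N + 1)).roots.toFinset

/-- The Christoffel number of the Gegenbauer-Gauss rule with `N + 1` nodes at the node `y`:
`ϖ⁻¹ = ∑_{j=0}^N (λ_j^{(α)})⁻¹ C_j^{(α)}(y)²`. -/
def christoffel (α : ℝ) (N : ℕ) (y : ℝ) : ℝ :=
  (∑ j ∈ Finset.range (N + 1),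
    (gegenbauerNormSq α j)⁻¹ * (gegenbauer α j).eval y ^ 2)⁻¹

/-- The Christoffel number on `[0, L]` at the shifted node `x = (L/2)(y + 1)`, that is
`(L/2)^{2α}` times the Christoffel number at `y = 2x/L - 1`. -/
def shiftedChristoffel (L α : ℝ) (N : ℕ) (x : ℝ) : ℝ :=
  (L / 2) ^ (2 * α) * christoffel α N (2 / L * x - 1)

/-- The second partial derivative `φ = u_xx`. -/
def uxx (u : ℝ → ℝ → ℝ) (x t : ℝ) : ℝ :=
  deriv (fun y => deriv (fun z => u z t) y) x

/-- The discrete shifted Gegenbauer coefficient `φ̃_{n,m}` of `φ = u_xx` with respect to the grid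
of shifted Gegenbauer-Gauss nodes on `[0, l] × [0, τ]`. -/
def discreteCoeff (l τ α : ℝ) (Nx Nt : ℕ) (u : ℝ → ℝ → ℝ) (n m : ℕ) : ℝ :=
  1 / (shiftedNormSq l α n * shiftedNormSq τ α m) *
    ∑ x ∈ sggNodes l α Nx, ∑ t ∈ sggNodes τ α Nt,
      (shiftedChristoffel l α Nx x * shiftedChristoffel τ α Nt t) * uxx u x t *
        ((shiftedGegenbauer l α n).eval x * (shiftedGegenbauer τ α m).eval t)

/-- `u` is a (classical) solution of the telegraph problem
`u_tt + β₁ u_t + β₂ u = u_xx + f` on `(0, l) × (0, τ)`, with initial data `g₁, g₂` and Dirichlet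
boundary data `h₁, h₂`. Every derivative that occurs is required to exist. -/
structure SolvesTelegraph (l τ β₁ β₂ : ℝ) (f : ℝ → ℝ → ℝ) (g₁ g₂ h₁ h₂ : ℝ → ℝ)
    (u : ℝ → ℝ → ℝ) : Prop where
  integrable_f : IntegrableOn (Function.uncurry f) (Ioo 0 l ×ˢ Ioo 0 τ)
  diff_t : ∀ x ∈ Ioo 0 l, ∀ t ∈ Ioo 0 τ, DifferentiableAt ℝ (fun s => u x s) t
  diff_tt : ∀ x ∈ Ioo 0 l, ∀ t ∈ Ioo 0 τ,
    DifferentiableAt ℝ (fun s => deriv (fun q => u x q) s) t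
  diff_x : ∀ x ∈ Ioo 0 l, ∀ t ∈ Ioo 0 τ, DifferentiableAt ℝ (fun y => u y t) x
  diff_xx : ∀ x ∈ Ioo 0 l, ∀ t ∈ Ioo 0 τ,
    DifferentiableAt ℝ (fun y => deriv (fun z => u z t) y) x
  pde : ∀ x ∈ Ioo 0 l, ∀ t ∈ Ioo 0 τ,
    deriv (fun s => deriv (fun q => u x q) s) t + β₁ * deriv (fun s => u x s) t + β₂ * u x t
      = uxx u x t + f x t
  init : ∀ x ∈ Ioo 0 l, u x 0 = g₁ x
  init_t : ∀ x ∈ Ioo 0 l, HasDerivWithinAt (fun s => u x s) (g₂ x) (Ici 0) 0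
  bdry_left : ∀ t ∈ Ioc 0 τ, u 0 t = h₁ t
  bdry_right : ∀ t ∈ Ioc 0 τ, u l t = h₂ t

/-- `u(·, t) ∈ ℙ_r` on `[0, l]` for every `t ∈ [0, τ]`: a polynomial in `x` of degree at most `r`
(with coefficients depending on `t`). -/
def PolynomialInX (l τ : ℝ) (r : ℕ) (u : ℝ → ℝ → ℝ) : Prop :=
  ∀ t ∈ Icc 0 τ, ∃ p : ℝ[X], p.natDegree ≤ r ∧ ∀ x ∈ Icc 0 l, u x t = p.eval x

/-- `u ∈ L^∞([0, l] × [0, τ])`. -/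
def MemLinf (l τ : ℝ) (u : ℝ → ℝ → ℝ) : Prop :=
  MemLp (Function.uncurry u) ∞ (volume.restrict (Icc 0 l ×ˢ Icc 0 τ))

/-- The norm of `u` in `L^∞([0, l] × [0, τ])`. -/
def linfNorm (l τ : ℝ) (u : ℝ → ℝ → ℝ) : ℝ :=
  (eLpNorm (Function.uncurry u) ∞ (volume.restrict (Icc 0 l ×ˢ Icc 0 τ))).toReal

/-- `(n + α) Γ(n + 2α)` for `α ≥ 0`; at `α = 0, n = 0`, where this reads `0 · Γ(0)`, it stands for
its limit `1/2` as `α → 0⁺`. -/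
def gammaTerm (α : ℝ) (n : ℕ) : ℝ :=
  if α = 0 ∧ n = 0 then 1 / 2 else (n + α) * Real.Gamma (n + 2 * α)

/-- For even `n`, the generalized binomial coefficient `(n/2 + α - 1 choose n/2)`. -/
def halfBinom (α : ℝ) (n : ℕ) : ℝ :=
  Ring.choose ((n : ℝ) / 2 + α - 1) (n / 2)

/-- `C_l = 4 C / l²`. -/
def constL (C l : ℝ) : ℝ := 4 * C / l ^ 2

/-- `D_1^{(α)}`. -/
def constD₁ (α : ℝ) : ℝ :=
  Real.pi ^ 2 * (2 : ℝ) ^ (3 - 4 * α) * Real.exp (-4 * α - 2) /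
    (Real.Gamma (α + 1 / 2) ^ 2 * Real.Gamma (α + 1) ^ 2)

/-- `D_2^{(α)} = A₁ A₂ D_1^{(α)}`. -/
def constD₂ (A₁ A₂ α : ℝ) : ℝ := A₁ * A₂ * constD₁ α

end

noncomputable section

/-! ### Recurrences for the Gegenbauer polynomials -/

/-! The estimate separates into a bound on `u_xx` and a bound on the Gauss sums. If |u_xx| ≤ B at
the nodes, the coefficient is at most B times the product over both variables of (1/λ_n) ∑ ϖ |C_n|.
Cauchy–Schwarz with ∑ ϖ ≤ λ_0 and ∑ ϖ C_n² ≤ λ_n bounds each factor by √R_n, where R_n = λ_0/λ_n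
(`sum_shiftedChristoffel_mul_abs_le`).

The two discrete inequalities do not need exactness of the quadrature or a count of the zeros. By
Christoffel–Darboux, the vectors (√ϖ_y C_j(y)/√λ_j)_{j ≤ N}, with y among the zeros of C_{N+1}, are
orthonormal in ℝ^{N+1}, and Bessel's inequality for a basis vector is the claim
(`sum_christoffel_mul_sq_le`).

For B, a polynomial of degree r bounded by M on [-1,1] has |p''(1)| ≤ T_r''(1) M ≤ r⁴ M. Rescaling
so that the given point is an end of a segment reaching the farther of 0 and l yields B = 16
r⁴‖u‖/l², hence C = 4 (`abs_uxx_le`). The essential supremum is a pointwise bound inside D because u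
is jointly continuous there, by Lagrange interpolation in x.

There remains √R_n. For α ≥ 0, R_n is an explicit Gamma quotient and R_n ≥ 1, so √R_n ≤ R_n. For α <
0, the two parity bounds follow by induction in steps of two. Euler's limit for Γ gives R_n ~
n^{2α}/(αΓ(2α)) when α ≠ 0, and R_n = 2 for n ≥ 1 when α = 0, whence the bounds for large n, m. -/

theorem gegenbauer_zero (α : ℝ) : gegenbauer α 0 = 1 := by simp [gegenbauer]

theorem gegenbauer_one (α : ℝ) : gegenbauer α 1 = X := by simp [gegenbauer]

theorem gegenbauer_recurrence {α : ℝ} (hα : -(1 / 2) < α) (n : ℕ) (x : ℝ) :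
    (n + 1 + 2 * α) * (gegenbauer α (n + 2)).eval x =
      2 * (n + 1 + α) * x * (gegenbauer α (n + 1)).eval x - (n + 1) * (gegenbauer α n).eval x := by
  have hn : (0 : ℝ) ≤ n := n.cast_nonneg
  have h : (n : ℝ) + 1 + 2 * α ≠ 0 := by linarith
  simp only [gegenbauer, eval_mul, eval_sub, eval_C, eval_X]
  push_cast
  field_simp

theorem gegenbauer_recurrence' {α : ℝ} (hα : -(1 / 2) < α) (n : ℕ) :
    C (n + 1 + 2 * α) * gegenbauer α (n + 2) =
      C (2 * (n + 1 + α)) * X * gegenbauer α (n + 1) - C ((n : ℝ) + 1) * gegenbauer α n := by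
  refine funext fun x => ?_
  simpa using gegenbauer_recurrence hα n x

/-- The two ladder relations need each other in the induction: differentiating the recurrence yields
the first at n + 1 from both at n, while the second at n + 1 is the first at n combined with the
recurrence. -/
theorem derivative_gegenbauer {α : ℝ} (hα : -(1 / 2) < α) (n : ℕ) (x : ℝ) :
    (1 - x ^ 2) * (derivative (gegenbauer α (n + 1))).eval x =
        (n + 1) * ((gegenbauer α n).eval x - x * (gegenbauer α (n + 1)).eval x) ∧
      (1 - x ^ 2) * (derivative (gegenbauer α n)).eval x =
        (n + 2 * α) * (x * (gegenbauer α n).eval x - (gegenbauer α (n + 1)).eval x) := by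
  induction n with
  | zero => simp [gegenbauer_zero, gegenbauer_one]; ring
  | succ n ih =>
    have hn : (0 : ℝ) ≤ n := n.cast_nonneg
    have h : (n : ℝ) + 1 + 2 * α ≠ 0 := by linarith
    have hr := gegenbauer_recurrence hα n x
    have hd := congrArg (fun p => (derivative p).eval x) (gegenbauer_recurrence' hα n)
    simp only [derivative_mul, derivative_C, derivative_X, derivative_sub, eval_add, eval_mul,
      eval_sub, eval_C, eval_X, zero_mul, zero_add, mul_one] at hd
    obtain ⟨h1, h2⟩ := ih
    push_cast
    constructor
    · apply mul_left_cancel₀ h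
      linear_combination (1 - x ^ 2) * hd + 2 * (n + 1 + α) * x * h1 - (n + 1) * h2 +
        (n + 2) * x * hr
    · linear_combination h1 + hr

theorem natDegree_gegenbauer_le (α : ℝ) (n : ℕ) : (gegenbauer α n).natDegree ≤ n := by
  induction n using Nat.strong_induction_on with
  | _ n ih =>
    match n with
    | 0 => simp [gegenbauer]
    | 1 => simp [gegenbauer]
    | n + 2 =>
      rw [gegenbauer]
      refine (natDegree_C_mul_le _ _).trans ((natDegree_sub_le _ _).trans (max_le ?_ ?_))
      · rw [mul_assoc]
        refine (natDegree_C_mul_le _ _).trans (natDegree_mul_le.trans ?_)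
        have := ih (n + 1) (by omega)
        rw [natDegree_X]; omega
      · exact (natDegree_C_mul_le _ _).trans ((ih n (by omega)).trans (by omega))

theorem gegenbauer_eval_neg {α : ℝ} (n : ℕ) (x : ℝ) :
    (gegenbauer α n).eval (-x) = (-1) ^ n * (gegenbauer α n).eval x := by
  induction n using Nat.strong_induction_on with
  | _ n ih =>
    match n with
    | 0 => simp [gegenbauer]
    | 1 => simp [gegenbauer]
    | n + 2 =>
      simp only [gegenbauer, eval_mul, eval_sub, eval_C, eval_X, ih (n + 1) (by omega),
        ih n (by omega)]
      ring

/-- Positivity on [1, ∞), together with parity, confines the zeros to (-1, 1), so that the nodes lie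
where the equation and the derivatives are available. Monotonicity in n is what drives the
induction. -/
theorem gegenbauer_eval_pos {α : ℝ} (hα : -(1 / 2) < α) {x : ℝ} (hx : 1 ≤ x) (n : ℕ) :
    0 < (gegenbauer α n).eval x ∧
      (gegenbauer α n).eval x ≤ (gegenbauer α (n + 1)).eval x := by
  induction n with
  | zero => simpa [gegenbauer] using hx
  | succ n ih =>
    have hn : (0 : ℝ) ≤ n := n.cast_nonneg
    have h : 0 < (n : ℝ) + 1 + 2 * α := by linarith
    have hr := gegenbauer_recurrence hα n x
    have hp := ih.1.trans_le ih.2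
    refine ⟨hp, le_of_mul_le_mul_left ?_ h⟩
    rw [hr]
    nlinarith [mul_nonneg (mul_nonneg (by linarith : (0 : ℝ) ≤ 2 * (n + 1 + α))
      (sub_nonneg.2 hx)) hp.le, ih.2]

theorem abs_lt_one_of_gegenbauer_eval_eq_zero {α : ℝ} (hα : -(1 / 2) < α) {n : ℕ} {x : ℝ}
    (h : (gegenbauer α n).eval x = 0) : |x| < 1 := by
  by_contra! hx
  rcases le_abs.1 hx with hx | hx
  · exact (gegenbauer_eval_pos hα hx n).1.ne' h
  · have := (gegenbauer_eval_pos hα hx n).1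
    rw [gegenbauer_eval_neg, h] at this
    simp at this

/-! ### The Gegenbauer weight -/

theorem one_sub_sq_nonneg {x : ℝ} (hx : x ∈ Icc (-1 : ℝ) 1) : 0 ≤ 1 - x ^ 2 := by
  nlinarith [hx.1, hx.2]

theorem one_sub_sq_pos {x : ℝ} (hx : x ∈ Ioo (-1 : ℝ) 1) : 0 < 1 - x ^ 2 := by
  nlinarith [hx.1, hx.2]

theorem intervalIntegrable_one_sub_sq_rpow {a : ℝ} (ha : -1 < a) :
    IntervalIntegrable (fun x : ℝ => (1 - x ^ 2) ^ a) volume (-1) 1 := by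
  have hr : IntervalIntegrable (fun x : ℝ => (1 - x ^ 2) ^ a) volume 0 1 := by
    have h1 : IntervalIntegrable (fun x : ℝ => (1 - x) ^ a) volume 0 1 := by
      simpa using (intervalIntegral.intervalIntegrable_rpow' (a := 1) (b := 0) ha).comp_sub_left 1
    have h2 : ContinuousOn (fun x : ℝ => (1 + x) ^ a) (uIcc 0 1) := by
      refine ContinuousOn.rpow_const (by fun_prop) fun x hx => Or.inl ?_
      rw [uIcc_of_le zero_le_one] at hx
      linarith [hx.1]
    refine (h1.mul_continuousOn h2).congr fun x hx => ?_
    rw [uIoc_of_le zero_le_one] at hx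
    rw [← Real.mul_rpow (by linarith [hx.2]) (by linarith [hx.1])]
    congr 1; ring
  have hl : IntervalIntegrable (fun x : ℝ => (1 - x ^ 2) ^ a) volume (-1) 0 := by
    have := (hr.comp_sub_left 0).symm
    simpa using this
  exact hl.trans hr

theorem intervalIntegrable_eval_mul_weight {α : ℝ} (hα : -(1 / 2) < α) (p : ℝ[X]) :
    IntervalIntegrable (fun x : ℝ => p.eval x * (1 - x ^ 2) ^ (α - 1 / 2)) volume (-1) 1 :=
  (intervalIntegrable_one_sub_sq_rpow (by linarith)).continuousOn_mul p.continuous.continuousOn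

/-- Integration of polynomials against the Gegenbauer weight `(1 - x²)^{α - 1/2}`. -/
def gegenbauerFunctional (α : ℝ) (hα : -(1 / 2) < α) : ℝ[X] →ₗ[ℝ] ℝ where
  toFun p := ∫ x in (-1 : ℝ)..1, p.eval x * (1 - x ^ 2) ^ (α - 1 / 2)
  map_add' p q := by
    rw [← intervalIntegral.integral_add (intervalIntegrable_eval_mul_weight hα p)
      (intervalIntegrable_eval_mul_weight hα q)]
    simp only [eval_add, add_mul]
  map_smul' c p := by
    simp only [eval_smul, smul_eq_mul, mul_assoc, intervalIntegral.integral_const_mul,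
      RingHom.id_apply]

theorem gegenbauerFunctional_C_mul {α : ℝ} (hα : -(1 / 2) < α) (c : ℝ) (p : ℝ[X]) :
    gegenbauerFunctional α hα (C c * p) = c * gegenbauerFunctional α hα p := by
  rw [← smul_eq_C_mul, map_smul, smul_eq_mul]

theorem gegenbauerFunctional_sq {α : ℝ} (hα : -(1 / 2) < α) (n : ℕ) :
    gegenbauerFunctional α hα (gegenbauer α n ^ 2) = gegenbauerNormSq α n := by
  simp [gegenbauerFunctional, gegenbauerNormSq]

/-- Integration by parts against the primitive (1 - x²)^{α+1/2} q, whose boundary values vanish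
because α > -1/2. Orthogonality and the norm recursion are both derived from this identity. -/
theorem gegenbauerFunctional_derivative {α : ℝ} (hα : -(1 / 2) < α) (q : ℝ[X]) :
    gegenbauerFunctional α hα ((1 - X ^ 2) * derivative q) =
      (2 * α + 1) * gegenbauerFunctional α hα (X * q) := by
  have key : gegenbauerFunctional α hα
      ((1 - X ^ 2) * derivative q - C (2 * α + 1) * (X * q)) = 0 := by
    have := intervalIntegral.integral_eq_sub_of_hasDerivAt_of_le (a := (-1 : ℝ)) (b := 1)
      (f := fun x => (1 - x ^ 2) ^ (α + 1 / 2) * q.eval x)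
      (f' := fun x => ((1 - X ^ 2) * derivative q - C (2 * α + 1) * (X * q)).eval x *
        (1 - x ^ 2) ^ (α - 1 / 2)) (by norm_num) ?_ ?_ ?_
    · rw [gegenbauerFunctional]
      simp only [LinearMap.coe_mk, AddHom.coe_mk]
      rw [this]
      have h0 : α + 1 / 2 ≠ 0 := by linarith
      have h0' : α + 2⁻¹ ≠ 0 := by linarith
      simp [Real.zero_rpow h0']
    · refine ContinuousOn.mul (ContinuousOn.rpow_const (by fun_prop) fun x hx => Or.inr ?_)
        q.continuous.continuousOn
      linarith
    · intro x hx
      have hp := one_sub_sq_pos hx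
      have h1 : HasDerivAt (fun x : ℝ => 1 - x ^ 2) (-(2 * x)) x := by
        simpa using (hasDerivAt_pow 2 x).const_sub 1
      have h2 := (h1.rpow_const (p := α + 1 / 2) (Or.inl hp.ne')).mul (q.hasDerivAt x)
      refine h2.congr_deriv ?_
      have e1 : α + 1 / 2 - 1 = α - 1 / 2 := by ring
      have e2 : (1 - x ^ 2) ^ (α + 1 / 2) = (1 - x ^ 2) ^ (α - 1 / 2) * (1 - x ^ 2) := by
        rw [← Real.rpow_add_one hp.ne']; congr 1; ring
      rw [e1, e2]
      simp only [eval_sub, eval_mul, eval_C, eval_X, eval_one, eval_pow]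
      ring
    · exact intervalIntegrable_eval_mul_weight hα _
  rw [map_sub, gegenbauerFunctional_C_mul, sub_eq_zero] at key
  exact key

/-! ### Orthogonality and the norms of the Gegenbauer polynomials -/

/-- The integration by parts identity for q = X^k C_{n+1}, simplified by the first ladder relation.
The truncated exponent k - 1 at k = 0 is harmless, since its coefficient k vanishes. -/
theorem gegenbauerFunctional_moment_succ {α : ℝ} (hα : -(1 / 2) < α) (n k : ℕ) :
    (n + 1 + k + 2 * α + 1) * gegenbauerFunctional α hα (X ^ (k + 1) * gegenbauer α (n + 1)) =
      (n + 1) * gegenbauerFunctional α hα (X ^ k * gegenbauer α n) +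
        k * gegenbauerFunctional α hα (X ^ (k - 1) * gegenbauer α (n + 1)) := by
  have h := gegenbauerFunctional_derivative hα (X ^ k * gegenbauer α (n + 1))
  have e : (1 - X ^ 2) * derivative (X ^ k * gegenbauer α (n + 1)) =
      C ((n : ℝ) + 1) * (X ^ k * gegenbauer α n)
        - C ((n : ℝ) + 1 + k) * (X ^ (k + 1) * gegenbauer α (n + 1))
        + C (k : ℝ) * (X ^ (k - 1) * gegenbauer α (n + 1)) := by
    refine funext fun x => ?_
    have hd := (derivative_gegenbauer hα n x).1
    simp only [derivative_mul, derivative_X_pow, eval_add, eval_mul, eval_sub, eval_C, eval_X,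
      eval_pow, eval_one]
    rcases k with _ | k
    · simp; linear_combination hd
    · simp only [Nat.add_sub_cancel]
      push_cast
      linear_combination x ^ (k + 1) * hd
  rw [e, map_add, map_sub, gegenbauerFunctional_C_mul, gegenbauerFunctional_C_mul,
    gegenbauerFunctional_C_mul, ← mul_assoc, ← pow_succ'] at h
  linear_combination -h

theorem gegenbauerFunctional_gegenbauer_succ {α : ℝ} (hα : -(1 / 2) < α) (n : ℕ) :
    gegenbauerFunctional α hα (gegenbauer α (n + 1)) = 0 := by
  have h1 : gegenbauerFunctional α hα (gegenbauer α 1) = 0 := by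
    have h := gegenbauerFunctional_derivative hα 1
    simp only [derivative_one, mul_zero, map_zero, mul_one] at h
    rw [gegenbauer_one]
    exact (mul_eq_zero.1 h.symm).resolve_left (by linarith)
  have hs (n : ℕ) : (n + 2 * α) * gegenbauerFunctional α hα (gegenbauer α (n + 1)) =
      (n - 1) * gegenbauerFunctional α hα (X * gegenbauer α n) := by
    have h := gegenbauerFunctional_derivative hα (gegenbauer α n)
    have e : (1 - X ^ 2) * derivative (gegenbauer α n) =
        C ((n : ℝ) + 2 * α) * (X * gegenbauer α n - gegenbauer α (n + 1)) := by
      refine funext fun x => ?_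
      simpa using (derivative_gegenbauer hα n x).2
    rw [e, gegenbauerFunctional_C_mul, map_sub] at h
    linear_combination -h
  induction n using Nat.strong_induction_on with
  | _ n ih =>
    match n with
    | 0 => exact h1
    | 1 =>
      -- The factor n - 1 in `hs` vanishes here. The case is separate because ∫ X C_1 against the
      -- weight is not zero.
      have := hs 1
      simp only [Nat.cast_one, sub_self, zero_mul] at this
      exact (mul_eq_zero.1 this).resolve_left (by linarith)
    | n + 2 =>
      have hn : (0 : ℝ) ≤ n := n.cast_nonneg
      have hm := gegenbauerFunctional_moment_succ hα (n + 1) 0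
      simp only [pow_zero, one_mul, Nat.cast_zero, zero_mul, add_zero, ih n (by omega), mul_zero,
        zero_add, pow_one] at hm
      push_cast at hm
      have hm' := (mul_eq_zero.1 hm).resolve_left (by linarith)
      have h2 := hs (n + 2)
      rw [hm', mul_zero] at h2
      push_cast at h2
      exact (mul_eq_zero.1 h2).resolve_left (by linarith)

theorem gegenbauerFunctional_X_pow_mul {α : ℝ} (hα : -(1 / 2) < α) {n k : ℕ} (h : k < n) :
    gegenbauerFunctional α hα (X ^ k * gegenbauer α n) = 0 := by
  induction k using Nat.strong_induction_on generalizing n with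
  | _ k ih =>
    obtain ⟨n, rfl⟩ : ∃ m, n = m + 1 := ⟨n - 1, by omega⟩
    rcases k with _ | k
    · simpa using gegenbauerFunctional_gegenbauer_succ hα n
    · have hn : (0 : ℝ) ≤ n := n.cast_nonneg
      have hk : (0 : ℝ) ≤ k := k.cast_nonneg
      have hm := gegenbauerFunctional_moment_succ hα n k
      rw [ih k (by omega) (by omega), mul_zero, zero_add] at hm
      have h0 : (k : ℝ) * gegenbauerFunctional α hα (X ^ (k - 1) * gegenbauer α (n + 1)) = 0 := by
        rcases k with _ | k
        · simp
        · rw [ih (k + 1 - 1) (by omega) (by omega), mul_zero]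
      rw [h0] at hm
      exact (mul_eq_zero.1 hm).resolve_left (by linarith)

theorem gegenbauerFunctional_mul_eq_zero {α : ℝ} (hα : -(1 / 2) < α) {n : ℕ} {p : ℝ[X]}
    (h : p.natDegree < n) : gegenbauerFunctional α hα (p * gegenbauer α n) = 0 := by
  rw [p.as_sum_range_C_mul_X_pow, Finset.sum_mul, map_sum]
  refine Finset.sum_eq_zero fun k hk => ?_
  rw [mul_assoc, gegenbauerFunctional_C_mul, gegenbauerFunctional_X_pow_mul hα, mul_zero]
  rw [Finset.mem_range] at hk; omega

/-- Integration by parts for q = C_n C_{n+1}. Combined with the recurrence multiplied by C_{n+2}, it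
gives a recursion for the norms without evaluating any integral. -/
theorem two_mul_gegenbauerFunctional_X_mul {α : ℝ} (hα : -(1 / 2) < α) (n : ℕ) :
    2 * gegenbauerFunctional α hα (X * (gegenbauer α n * gegenbauer α (n + 1))) =
      (n + 1) * gegenbauerNormSq α n - (n + 2 * α) * gegenbauerNormSq α (n + 1) := by
  have h := gegenbauerFunctional_derivative hα (gegenbauer α n * gegenbauer α (n + 1))
  have e : (1 - X ^ 2) * derivative (gegenbauer α n * gegenbauer α (n + 1)) =
      C (2 * α - 1) * (X * (gegenbauer α n * gegenbauer α (n + 1)))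
        - C ((n : ℝ) + 2 * α) * gegenbauer α (n + 1) ^ 2
        + C ((n : ℝ) + 1) * gegenbauer α n ^ 2 := by
    refine funext fun x => ?_
    obtain ⟨h1, h2⟩ := derivative_gegenbauer hα n x
    simp only [derivative_mul, eval_add, eval_mul, eval_sub, eval_C, eval_X, eval_pow, eval_one]
    linear_combination (gegenbauer α n).eval x * h1 + (gegenbauer α (n + 1)).eval x * h2
  rw [e, map_add, map_sub, gegenbauerFunctional_C_mul, gegenbauerFunctional_C_mul,
    gegenbauerFunctional_C_mul, gegenbauerFunctional_sq, gegenbauerFunctional_sq] at h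
  linear_combination -h

theorem gegenbauerNormSq_one {α : ℝ} (hα : -(1 / 2) < α) :
    2 * (1 + α) * gegenbauerNormSq α 1 = gegenbauerNormSq α 0 := by
  have h := two_mul_gegenbauerFunctional_X_mul hα 0
  have h1 := gegenbauerFunctional_sq hα 1
  rw [gegenbauer_one] at h1
  rw [gegenbauer_zero, gegenbauer_one, one_mul, ← sq, h1] at h
  push_cast at h
  linear_combination h

theorem gegenbauerNormSq_succ {α : ℝ} (hα : -(1 / 2) < α) (n : ℕ) :
    (n + 1 + 2 * α) * (n + 2 + α) * gegenbauerNormSq α (n + 2) =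
      (n + 1 + α) * (n + 2) * gegenbauerNormSq α (n + 1) := by
  have h := two_mul_gegenbauerFunctional_X_mul hα (n + 1)
  have h0 := gegenbauerFunctional_mul_eq_zero hα (n := n + 2) (p := gegenbauer α n)
    ((natDegree_gegenbauer_le α n).trans_lt (by omega))
  have e : C ((n : ℝ) + 1 + 2 * α) * gegenbauer α (n + 2) ^ 2 =
      C (2 * ((n : ℝ) + 1 + α)) * (X * (gegenbauer α (n + 1) * gegenbauer α (n + 2)))
        - C ((n : ℝ) + 1) * (gegenbauer α n * gegenbauer α (n + 2)) := by
    linear_combination gegenbauer α (n + 2) * gegenbauer_recurrence' hα n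
  have e' := congrArg (gegenbauerFunctional α hα) e
  rw [map_sub, gegenbauerFunctional_C_mul, gegenbauerFunctional_C_mul, gegenbauerFunctional_C_mul,
    h0, gegenbauerFunctional_sq] at e'
  push_cast at h e'
  linear_combination e' + (n + 1 + α) * h

theorem gegenbauerNormSq_zero_pos {α : ℝ} (hα : -(1 / 2) < α) : 0 < gegenbauerNormSq α 0 := by
  have hi := intervalIntegrable_eval_mul_weight hα (gegenbauer α 0 ^ 2)
  simp only [eval_pow] at hi
  refine intervalIntegral.intervalIntegral_pos_of_pos_on hi (fun x hx => ?_) (by norm_num)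
  have := one_sub_sq_pos hx
  simp only [gegenbauer_zero, eval_one, one_pow, one_mul]
  positivity

theorem gegenbauerNormSq_pos {α : ℝ} (hα : -(1 / 2) < α) (n : ℕ) : 0 < gegenbauerNormSq α n := by
  have h1 : 0 < gegenbauerNormSq α 1 := by
    have := gegenbauerNormSq_zero_pos hα
    rw [← gegenbauerNormSq_one hα] at this
    exact pos_of_mul_pos_right this (by linarith)
  rcases n with _ | n
  · exact gegenbauerNormSq_zero_pos hα
  · induction n with
    | zero => exact h1
    | succ n ih =>
      have hn : (0 : ℝ) ≤ n := n.cast_nonneg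
      have h := gegenbauerNormSq_succ hα n
      have hl : 0 < (n + 1 + α) * (n + 2) * gegenbauerNormSq α (n + 1) :=
        mul_pos (mul_pos (by linarith) (by linarith)) ih
      rw [← h] at hl
      exact pos_of_mul_pos_right hl (mul_nonneg (by linarith) (by linarith))

/-! ### The Christoffel–Darboux formula and the Gauss rule -/

theorem christoffel_darboux {α : ℝ} (hα : -(1 / 2) < α) (N : ℕ) (x y : ℝ) :
    (x - y) * ∑ j ∈ Finset.range (N + 1),
        (gegenbauerNormSq α j)⁻¹ * ((gegenbauer α j).eval x * (gegenbauer α j).eval y) =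
      (N + 1) / (2 * (N + 1 + α) * gegenbauerNormSq α (N + 1)) *
        ((gegenbauer α (N + 1)).eval x * (gegenbauer α N).eval y -
          (gegenbauer α N).eval x * (gegenbauer α (N + 1)).eval y) := by
  induction N with
  | zero =>
    have h1 := gegenbauerNormSq_one hα
    have h0 := (gegenbauerNormSq_pos hα 0).ne'
    simp only [zero_add, Finset.sum_range_one, gegenbauer_zero, gegenbauer_one, eval_one, eval_X,
      Nat.cast_zero, h1]
    field_simp
  | succ N ih =>
    have hN : (0 : ℝ) ≤ N := N.cast_nonneg
    have h1 := (gegenbauerNormSq_pos hα (N + 1)).ne'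
    have h2 := (gegenbauerNormSq_pos hα (N + 2)).ne'
    have hs := gegenbauerNormSq_succ hα N
    have ha1 : (N : ℝ) + 1 + α ≠ 0 := by linarith
    have ha2 : (N : ℝ) + 2 + α ≠ 0 := by linarith
    have ha3 : (N : ℝ) + 1 + 1 + α ≠ 0 := by linarith
    -- By the norm recursion the new leading constant acquires the same denominator as the old one,
    -- so that only the three-term recurrences at x and y are left.
    have hc : ((N + 1 : ℕ) + 1 : ℝ) / (2 * ((N + 1 : ℕ) + 1 + α) * gegenbauerNormSq α (N + 2)) =
        (N + 1 + 2 * α) / (2 * (N + 1 + α) * gegenbauerNormSq α (N + 1)) := by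
      push_cast
      rw [div_eq_div_iff (by positivity) (by positivity)]
      linear_combination -2 * hs
    rw [Finset.sum_range_succ, mul_add, ih, hc]
    have hx := gegenbauer_recurrence hα N x
    have hy := gegenbauer_recurrence hα N y
    field_simp
    linear_combination (gegenbauer α (N + 1)).eval x * hy - (gegenbauer α (N + 1)).eval y * hx

theorem christoffel_inv_pos {α : ℝ} (hα : -(1 / 2) < α) (N : ℕ) (y : ℝ) :
    0 < ∑ j ∈ Finset.range (N + 1), (gegenbauerNormSq α j)⁻¹ * (gegenbauer α j).eval y ^ 2 := by
  refine Finset.sum_pos' (fun j _ => ?_) ⟨0, by simp, ?_⟩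
  · have := gegenbauerNormSq_pos hα j
    positivity
  · have := gegenbauerNormSq_pos hα 0
    simp only [gegenbauer_zero, eval_one]
    positivity

theorem christoffel_pos {α : ℝ} (hα : -(1 / 2) < α) (N : ℕ) (y : ℝ) : 0 < christoffel α N y :=
  inv_pos.2 (christoffel_inv_pos hα N y)

/-- Bessel's inequality for the n-th standard basis vector of ℝ^{N+1}. Distinct zeros give
orthogonal vectors because the right side of Christoffel–Darboux vanishes, and the Christoffel
number is exactly the normalizing factor. Any finite set of zeros will do. -/
theorem sum_christoffel_mul_sq_le {α : ℝ} (hα : -(1 / 2) < α) {N n : ℕ} (hn : n ≤ N)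
    (S : Finset ℝ) (hS : ∀ y ∈ S, (gegenbauer α (N + 1)).eval y = 0) :
    ∑ y ∈ S, christoffel α N y * (gegenbauer α n).eval y ^ 2 ≤ gegenbauerNormSq α n := by
  let v : S → EuclideanSpace ℝ (Fin (N + 1)) := fun y => WithLp.toLp 2 fun j =>
    √(christoffel α N y) * ((gegenbauer α j).eval (y : ℝ) * √((gegenbauerNormSq α j)⁻¹))
  have hinner (s t : S) : inner ℝ (v s) (v t) = √(christoffel α N s) * √(christoffel α N t) *
      ∑ j ∈ Finset.range (N + 1), (gegenbauerNormSq α j)⁻¹ *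
        ((gegenbauer α j).eval (s : ℝ) * (gegenbauer α j).eval (t : ℝ)) := by
    rw [PiLp.inner_apply, Finset.mul_sum, ← Fin.sum_univ_eq_sum_range
      (fun j => √(christoffel α N s) * √(christoffel α N t) * ((gegenbauerNormSq α j)⁻¹ *
        ((gegenbauer α j).eval (s : ℝ) * (gegenbauer α j).eval (t : ℝ))))]
    refine Finset.sum_congr rfl fun j _ => ?_
    have h := Real.mul_self_sqrt (inv_pos.2 (gegenbauerNormSq_pos hα j)).le
    simp only [v, RCLike.inner_apply, conj_trivial]
    linear_combination √(christoffel α N s) * √(christoffel α N t) *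
      (gegenbauer α j).eval (s : ℝ) * (gegenbauer α j).eval (t : ℝ) * h
  have hv : Orthonormal ℝ v := by
    rw [orthonormal_iff_ite]
    intro s t
    rw [hinner]
    split_ifs with hst
    · subst hst
      have h := christoffel_inv_pos hα N s
      rw [Real.mul_self_sqrt (christoffel_pos hα N s).le, christoffel]
      simp only [← sq]
      exact inv_mul_cancel₀ h.ne'
    · have h := christoffel_darboux hα N s t
      rw [hS s s.2, hS t t.2] at h
      simp only [zero_mul, mul_zero, sub_zero] at h
      rw [(mul_eq_zero.1 h).resolve_left (sub_ne_zero.2 fun h => hst (Subtype.ext h)), mul_zero]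
  have hB := hv.sum_inner_products_le
    (EuclideanSpace.single (⟨n, by omega⟩ : Fin (N + 1)) (1 : ℝ)) (s := Finset.univ)
  have hpos := gegenbauerNormSq_pos hα n
  have hterm (y : S) : ‖inner ℝ (v y) (EuclideanSpace.single (⟨n, by omega⟩ : Fin (N + 1)) (1 : ℝ))‖
      ^ 2 = christoffel α N y * (gegenbauer α n).eval (y : ℝ) ^ 2 * (gegenbauerNormSq α n)⁻¹ := by
    rw [EuclideanSpace.inner_single_right]
    simp only [v, conj_trivial, one_mul, Real.norm_eq_abs, sq_abs, mul_pow,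
      Real.sq_sqrt (christoffel_pos hα N y).le, Real.sq_sqrt (inv_pos.2 hpos).le]
    ring
  simp only [hterm] at hB
  rw [← Finset.sum_mul, Finset.sum_coe_sort S (fun y => christoffel α N y *
    (gegenbauer α n).eval y ^ 2)] at hB
  simp only [PiLp.norm_single, norm_one, one_pow] at hB
  rwa [← div_eq_mul_inv, div_le_one hpos] at hB

/-! ### Shifting to `[0, L]` -/

theorem shiftedGegenbauer_eval (L α : ℝ) (n : ℕ) (x : ℝ) :
    (shiftedGegenbauer L α n).eval x = (gegenbauer α n).eval (2 / L * x - 1) := by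
  simp [shiftedGegenbauer]

theorem shiftedNormSq_eq {L : ℝ} (hL : 0 < L) (α : ℝ) (n : ℕ) :
    shiftedNormSq L α n = (L / 2) ^ (2 * α) * gegenbauerNormSq α n := by
  have h2 : 2 / L ≠ 0 := by positivity
  have hL2 : 0 < L / 2 := by positivity
  have h := intervalIntegral.integral_comp_mul_sub (a := 0) (b := L)
    (fun y => (gegenbauer α n).eval y ^ 2 * (1 - y ^ 2) ^ (α - 1 / 2)) h2 1
  have e1 : 2 / L * 0 - 1 = -1 := by ring
  have e2 : 2 / L * L - 1 = 1 := by field_simp; norm_num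
  rw [e1, e2] at h
  -- The weight contributes (L/2)^{2α-1} and the substitution dx = (L/2) dy the remaining factor.
  have hpow : (L / 2) ^ (2 * α) = ((L / 2) ^ 2) ^ (α - 1 / 2) * (2 / L)⁻¹ := by
    rw [← Real.rpow_natCast, ← Real.rpow_mul hL2.le, inv_div, ← Real.rpow_add_one hL2.ne']
    congr 1; push_cast; ring
  rw [shiftedNormSq, gegenbauerNormSq, hpow, mul_assoc, ← smul_eq_mul (2 / L)⁻¹, ← h,
    ← intervalIntegral.integral_const_mul]
  refine intervalIntegral.integral_congr fun x hx => ?_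
  rw [uIcc_of_le hL.le] at hx
  have hx' : 2 / L * x - 1 ∈ Icc (-1 : ℝ) 1 := by
    constructor
    · have := mul_nonneg (by positivity : 0 ≤ 2 / L) hx.1
      linarith
    · have := mul_le_mul_of_nonneg_left hx.2 (by positivity : 0 ≤ 2 / L)
      linarith
  have e3 : L * x - x ^ 2 = (L / 2) ^ 2 * (1 - (2 / L * x - 1) ^ 2) := by
    field_simp; ring
  simp only [shiftedGegenbauer_eval]
  rw [e3, Real.mul_rpow (by positivity) (one_sub_sq_nonneg hx')]
  ring

theorem eval_eq_zero_of_mem_sggNodes {L α : ℝ} {N : ℕ} {x : ℝ} (hx : x ∈ sggNodes L α N) :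
    (gegenbauer α (N + 1)).eval (2 / L * x - 1) = 0 := by
  rw [sggNodes, Multiset.mem_toFinset] at hx
  rw [← shiftedGegenbauer_eval]
  exact (isRoot_of_mem_roots hx)

theorem sggNodes_subset_Ioo {L α : ℝ} (hL : 0 < L) (hα : -(1 / 2) < α) {N : ℕ} {x : ℝ}
    (hx : x ∈ sggNodes L α N) : x ∈ Ioo 0 L := by
  have h := abs_lt.1 (abs_lt_one_of_gegenbauer_eval_eq_zero hα (eval_eq_zero_of_mem_sggNodes hx))
  have hL2 : 0 < L / 2 := by positivity
  have e : x = L / 2 * (2 / L * x - 1 + 1) := by field_simp; ring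
  constructor
  · rw [e]; exact mul_pos hL2 (by linarith [h.1])
  · rw [e]; nlinarith [h.2]

theorem shiftedChristoffel_nonneg {L α : ℝ} (hL : 0 < L) (hα : -(1 / 2) < α) (N : ℕ) (x : ℝ) :
    0 ≤ shiftedChristoffel L α N x :=
  mul_nonneg (by positivity) (christoffel_pos hα N _).le

theorem sum_shiftedChristoffel_mul_sq_le {L α : ℝ} (hL : 0 < L) (hα : -(1 / 2) < α) {N n : ℕ}
    (hn : n ≤ N) :
    ∑ x ∈ sggNodes L α N, shiftedChristoffel L α N x * (shiftedGegenbauer L α n).eval x ^ 2 ≤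
      shiftedNormSq L α n := by
  have h2 : 2 / L ≠ 0 := by positivity
  have hinj : Set.InjOn (fun x : ℝ => 2 / L * x - 1) (sggNodes L α N) := by
    intro x _ y _ hxy
    simpa [hL.ne'] using hxy
  have h := sum_christoffel_mul_sq_le hα hn ((sggNodes L α N).image fun x => 2 / L * x - 1) (by
    intro y hy
    obtain ⟨x, hx, rfl⟩ := Finset.mem_image.1 hy
    exact eval_eq_zero_of_mem_sggNodes hx)
  rw [Finset.sum_image hinj] at h
  rw [shiftedNormSq_eq hL]
  refine le_trans (le_of_eq ?_) (mul_le_mul_of_nonneg_left h (by positivity))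
  rw [Finset.mul_sum]
  exact Finset.sum_congr rfl fun x _ => by
    rw [shiftedChristoffel, shiftedGegenbauer_eval, mul_assoc]

/-- The ratio `λ_0 / λ_n` of the squared norms of the Gegenbauer polynomials. -/
def normRatio (α : ℝ) (n : ℕ) : ℝ := gegenbauerNormSq α 0 / gegenbauerNormSq α n

theorem sum_shiftedChristoffel_mul_abs_le {L α : ℝ} (hL : 0 < L) (hα : -(1 / 2) < α) {N n : ℕ}
    (hn : n ≤ N) :
    ∑ x ∈ sggNodes L α N, shiftedChristoffel L α N x * |(shiftedGegenbauer L α n).eval x| ≤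
      shiftedNormSq L α n * √(normRatio α n) := by
  -- Since C_0 = 1, this is the bound ∑ ϖ ≤ λ_0 on the total mass.
  have h0 := sum_shiftedChristoffel_mul_sq_le hL hα (Nat.zero_le N)
  have h1 := sum_shiftedChristoffel_mul_sq_le hL hα hn
  have hl0 := gegenbauerNormSq_pos hα 0
  have hln := gegenbauerNormSq_pos hα n
  have hc : 0 < (L / 2) ^ (2 * α) := by positivity
  have hcs := Finset.sum_mul_sq_le_sq_mul_sq (sggNodes L α N)
    (fun x => √(shiftedChristoffel L α N x))
    (fun x => √(shiftedChristoffel L α N x) * |(shiftedGegenbauer L α n).eval x|)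
  simp only [shiftedGegenbauer_eval, gegenbauer_zero, eval_one, one_pow, mul_one] at h0
  simp only [← mul_assoc, Real.mul_self_sqrt (shiftedChristoffel_nonneg hL hα N _), mul_pow,
    Real.sq_sqrt (shiftedChristoffel_nonneg hL hα N _), sq_abs] at hcs
  have hp : 0 < shiftedNormSq L α n := by rw [shiftedNormSq_eq hL]; positivity
  have hp0 : 0 < shiftedNormSq L α 0 := by rw [shiftedNormSq_eq hL]; positivity
  have hR : 0 ≤ normRatio α n := div_nonneg hl0.le hln.le
  refine le_of_pow_le_pow_left₀ two_ne_zero (by positivity) (hcs.trans ?_)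
  rw [mul_pow, Real.sq_sqrt hR]
  refine (mul_le_mul h0 h1 (Finset.sum_nonneg fun x _ => mul_nonneg
    (shiftedChristoffel_nonneg hL hα N x) (sq_nonneg _)) hp0.le).trans (le_of_eq ?_)
  rw [shiftedNormSq_eq hL, shiftedNormSq_eq hL, normRatio]
  field_simp

theorem abs_discreteCoeff_le {l τ α : ℝ} (hl : 0 < l) (hτ : 0 < τ) (hα : -(1 / 2) < α)
    {Nx Nt n m : ℕ} (hn : n ≤ Nx) (hm : m ≤ Nt) {u : ℝ → ℝ → ℝ} {B : ℝ}
    (hB : ∀ x ∈ Ioo 0 l, ∀ t ∈ Ioo 0 τ, |uxx u x t| ≤ B) (hB0 : 0 ≤ B) :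
    |discreteCoeff l τ α Nx Nt u n m| ≤ B * √(normRatio α n) * √(normRatio α m) := by
  have hp {L : ℝ} (hL : 0 < L) (k : ℕ) : 0 < shiftedNormSq L α k := by
    have := gegenbauerNormSq_pos hα k
    rw [shiftedNormSq_eq hL]; positivity
  have hpn := hp hl n
  have hpm := hp hτ m
  have hsum : |∑ x ∈ sggNodes l α Nx, ∑ t ∈ sggNodes τ α Nt,
      (shiftedChristoffel l α Nx x * shiftedChristoffel τ α Nt t) * uxx u x t *
        ((shiftedGegenbauer l α n).eval x * (shiftedGegenbauer τ α m).eval t)| ≤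
      B * ((∑ x ∈ sggNodes l α Nx,
          shiftedChristoffel l α Nx x * |(shiftedGegenbauer l α n).eval x|) *
        ∑ t ∈ sggNodes τ α Nt,
          shiftedChristoffel τ α Nt t * |(shiftedGegenbauer τ α m).eval t|) := by
    rw [Finset.sum_mul_sum, Finset.mul_sum]
    refine (Finset.abs_sum_le_sum_abs _ _).trans (Finset.sum_le_sum fun x hx => ?_)
    rw [Finset.mul_sum]
    refine (Finset.abs_sum_le_sum_abs _ _).trans (Finset.sum_le_sum fun t ht => ?_)
    have hu := hB x (sggNodes_subset_Ioo hl hα hx) t (sggNodes_subset_Ioo hτ hα ht)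
    have hx0 := shiftedChristoffel_nonneg hl hα Nx x
    have ht0 := shiftedChristoffel_nonneg hτ hα Nt t
    rw [abs_mul, abs_mul, abs_mul, abs_mul, abs_of_nonneg hx0, abs_of_nonneg ht0]
    calc _ = |uxx u x t| * (shiftedChristoffel l α Nx x * |(shiftedGegenbauer l α n).eval x| *
          (shiftedChristoffel τ α Nt t * |(shiftedGegenbauer τ α m).eval t|)) := by ring
      _ ≤ _ := mul_le_mul_of_nonneg_right hu (by positivity)
  have h1 := sum_shiftedChristoffel_mul_abs_le hl hα hn
  have h2 := sum_shiftedChristoffel_mul_abs_le hτ hα hm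
  rw [discreteCoeff, abs_mul, abs_of_pos (by positivity)]
  refine (mul_le_mul_of_nonneg_left (hsum.trans (mul_le_mul_of_nonneg_left
    (mul_le_mul h1 h2 (Finset.sum_nonneg fun x _ => mul_nonneg
      (shiftedChristoffel_nonneg hτ hα Nt x) (abs_nonneg _)) (by positivity)) hB0))
    (by positivity)).trans (le_of_eq ?_)
  field_simp

/-! ### A Markov inequality for second derivatives -/

/-- The exact value is n²(n² - 1)/3. -/
theorem iterate_derivative_two_T_eval_one_le (n : ℕ) :
    (derivative^[2] (Chebyshev.T ℝ n)).eval 1 ≤ (n : ℝ) ^ 4 := by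
  have h := Chebyshev.iterate_derivative_T_eval_one (R := ℝ) n 2
  have e1 : (∏ l ∈ Finset.range 2, (2 * (l : ℝ) + 1)) = 3 := by
    rw [Finset.prod_range_succ, Finset.prod_range_one]; norm_num
  have e2 : (∏ l ∈ Finset.range 2, (((n : ℤ) : ℝ) ^ 2 - (l : ℝ) ^ 2)) =
      (n : ℝ) ^ 2 * ((n : ℝ) ^ 2 - 1) := by
    rw [Finset.prod_range_succ, Finset.prod_range_one]; norm_num
  push_cast at h
  simp only [Int.cast_natCast] at h e2
  rw [e1, e2] at h
  nlinarith [sq_nonneg (n : ℝ), sq_nonneg ((n : ℝ) ^ 2)]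

theorem abs_second_derivative_eval_one_le {p : ℝ[X]} {r : ℕ} (hp : p.natDegree ≤ r) {M : ℝ}
    (hM : ∀ x ∈ Icc (-1 : ℝ) 1, |p.eval x| ≤ M) :
    |(derivative (derivative p)).eval 1| ≤ M * (r : ℝ) ^ 4 := by
  have key {q : ℝ[X]} (hq : q.natDegree ≤ r) {K : ℝ} (hK : 0 < K)
      (h : ∀ x ∈ Icc (-1 : ℝ) 1, |q.eval x| ≤ K) :
      (derivative (derivative q)).eval 1 ≤ K * (r : ℝ) ^ 4 := by
    have h1 := Chebyshev.eval_iterate_derivative_le_of_forall_abs_le_one (n := r) (k := 2)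
      (P := C K⁻¹ * q) le_rfl
      (degree_le_of_natDegree_le ((natDegree_C_mul_le _ _).trans hq)) (fun x hx => by
        rw [eval_mul, eval_C, abs_mul, abs_of_pos (inv_pos.2 hK), inv_mul_le_iff₀ hK, mul_one]
        exact h x hx)
    have h2 := h1.trans (iterate_derivative_two_T_eval_one_le r)
    simpa [derivative_C_mul, inv_mul_le_iff₀ hK] using h2
  have hM0 : 0 ≤ M := (abs_nonneg _).trans (hM 0 (by simp))
  -- Normalization divides by the bound, and M may be 0; hence the passage through K > M and the
  -- limit K → M.
  have hall (K : ℝ) (hK : M < K) : |(derivative (derivative p)).eval 1| ≤ K * (r : ℝ) ^ 4 := by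
    have hK0 := hM0.trans_lt hK
    refine abs_le'.2 ⟨key hp hK0 fun x hx => (hM x hx).trans hK.le, ?_⟩
    have := key (q := -p) (by rwa [natDegree_neg]) hK0
      (fun x hx => by rw [eval_neg, abs_neg]; exact (hM x hx).trans hK.le)
    simpa using this
  have ht : Filter.Tendsto (fun K : ℝ => K * (r : ℝ) ^ 4) (nhdsWithin M (Ioi M))
      (nhds (M * (r : ℝ) ^ 4)) :=
    ((continuous_id.mul continuous_const).tendsto M).mono_left nhdsWithin_le_nhds
  exact ge_of_tendsto ht (Filter.eventually_of_mem self_mem_nhdsWithin hall)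

/-- The affine map sending -1 to a and 1 to x turns x into an endpoint, where the Chebyshev
comparison applies. Keeping (x - a)² on the left allows a = x. -/
theorem abs_second_derivative_eval_le_of_segment {p : ℝ[X]} {r : ℕ} (hp : p.natDegree ≤ r)
    {M a x : ℝ} (hM : ∀ y ∈ uIcc a x, |p.eval y| ≤ M) :
    (x - a) ^ 2 * |(derivative (derivative p)).eval x| ≤ 4 * (M * (r : ℝ) ^ 4) := by
  have hq := abs_second_derivative_eval_one_le (r := r) (M := M)
    (p := p.comp (C ((x - a) / 2) * X + C ((x + a) / 2))) ?_ ?_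
  · have e : (derivative (derivative (p.comp (C ((x - a) / 2) * X + C ((x + a) / 2))))).eval 1 =
        ((x - a) / 2) ^ 2 * (derivative (derivative p)).eval x := by
      simp only [derivative_comp, derivative_add, derivative_C_mul, derivative_X, derivative_C,
        mul_one, add_zero, eval_mul, eval_C, eval_comp, eval_add, eval_X]
      rw [show (x - a) / 2 + (x + a) / 2 = x by ring]
      ring
    rw [e, abs_mul, abs_of_nonneg (sq_nonneg _)] at hq
    linarith
  · refine natDegree_comp_le.trans ((Nat.mul_le_mul hp natDegree_linear_le).trans (by simp))
  · intro y hy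
    rw [eval_comp]
    apply hM
    simp only [eval_add, eval_mul, eval_C, eval_X]
    rw [mem_uIcc]
    rcases le_total a x with h | h
    · left; constructor <;> nlinarith [hy.1, hy.2]
    · right; constructor <;> nlinarith [hy.1, hy.2]

theorem abs_second_derivative_eval_le {p : ℝ[X]} {r : ℕ} (hp : p.natDegree ≤ r) {M l : ℝ}
    (hl : 0 < l) (hM : ∀ y ∈ Icc 0 l, |p.eval y| ≤ M) {x : ℝ} (hx : x ∈ Icc 0 l) :
    |(derivative (derivative p)).eval x| ≤ constL 4 l * (r : ℝ) ^ 4 * M := by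
  -- Taking a as the endpoint farther from x gives |x - a| ≥ l/2, hence the constant 4/(l/2)² =
  -- 16/l².
  obtain ⟨a, ha, hal⟩ : ∃ a ∈ Icc 0 l, (l / 2) ^ 2 ≤ (x - a) ^ 2 := by
    rcases le_total x (l / 2) with h | h
    · exact ⟨l, ⟨hl.le, le_rfl⟩, by nlinarith [hx.1]⟩
    · exact ⟨0, ⟨le_rfl, hl.le⟩, by nlinarith [hx.1]⟩
  have h := abs_second_derivative_eval_le_of_segment hp
    (fun y hy => hM y (ordConnected_Icc.uIcc_subset ha hx hy))
  have h2 := (mul_le_mul_of_nonneg_right hal (abs_nonneg _)).trans h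
  have e : constL 4 l * (r : ℝ) ^ 4 * M = 4 * (M * (r : ℝ) ^ 4) / (l / 2) ^ 2 := by
    rw [constL]; field_simp; ring
  rw [e, le_div_iff₀ (by positivity)]
  linarith

/-! ### From the essential supremum to a pointwise bound -/

theorem continuousOn_of_polynomialInX {l τ : ℝ} (hl : 0 < l) {r : ℕ} {u : ℝ → ℝ → ℝ}
    (hu : PolynomialInX l τ r u) (hc : ∀ x ∈ Ioo 0 l, ContinuousOn (fun t => u x t) (Ioo 0 τ)) :
    ContinuousOn (Function.uncurry u) (Ioo 0 l ×ˢ Ioo 0 τ) := by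
  -- The interpolation points avoid 0 and l, since continuity in t is assumed only for interior x.
  let v : ℕ → ℝ := fun i => l * ((i + 1) / (r + 2))
  have hv (i : ℕ) (hi : i ∈ Finset.range (r + 1)) : v i ∈ Ioo 0 l := by
    have hi' : (i : ℝ) + 1 < r + 2 := by
      have := Finset.mem_range.1 hi
      exact_mod_cast (by omega : i + 1 < r + 2)
    have h1 : ((i : ℝ) + 1) / (r + 2) < 1 := (div_lt_one (by positivity)).2 hi'
    exact ⟨by positivity, by nlinarith⟩
  have hinj : Set.InjOn v (Finset.range (r + 1)) := by
    intro i _ j _ hij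
    have hr : (r : ℝ) + 2 ≠ 0 := by positivity
    have := mul_left_cancel₀ hl.ne' hij
    field_simp at this
    exact_mod_cast add_right_cancel this
  have heq : EqOn (Function.uncurry u) (fun z => ∑ i ∈ Finset.range (r + 1),
      u (v i) z.2 * (Lagrange.basis (Finset.range (r + 1)) v i).eval z.1)
      (Ioo 0 l ×ˢ Ioo 0 τ) := by
    rintro ⟨x, t⟩ ⟨hx, ht⟩
    obtain ⟨p, hp, hpu⟩ := hu t (Ioo_subset_Icc_self ht)
    have hdeg : p.degree < (Finset.range (r + 1)).card := by
      rw [Finset.card_range]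
      exact (degree_le_of_natDegree_le hp).trans_lt (by exact_mod_cast Nat.lt_succ_self r)
    have hint := congrArg (eval x) (Lagrange.eq_interpolate hinj hdeg)
    rw [Lagrange.interpolate_apply, eval_finsetSum] at hint
    simp only [Function.uncurry_apply_pair]
    rw [hpu x (Ioo_subset_Icc_self hx), hint]
    refine Finset.sum_congr rfl fun i hi => ?_
    rw [eval_mul, eval_C, hpu _ (Ioo_subset_Icc_self (hv i hi))]
  refine ContinuousOn.congr ?_ heq
  refine continuousOn_finsetSum _ fun i hi => ContinuousOn.mul ?_ ?_
  · exact (hc _ (hv i hi)).comp continuousOn_snd fun z hz => hz.2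
  · exact ((Lagrange.basis (Finset.range (r + 1)) v i).continuous.comp continuous_fst).continuousOn

theorem abs_le_linfNorm {l τ : ℝ} {u : ℝ → ℝ → ℝ} (hu : MemLinf l τ u)
    (hc : ContinuousOn (Function.uncurry u) (Ioo 0 l ×ˢ Ioo 0 τ)) {x t : ℝ}
    (hx : x ∈ Ioo 0 l) (ht : t ∈ Ioo 0 τ) : |u x t| ≤ linfNorm l τ u := by
  have hae : ∀ᵐ z ∂(volume.restrict (Icc 0 l ×ˢ Icc 0 τ)),
      |Function.uncurry u z| ≤ linfNorm l τ u := by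
    have h := ae_le_eLpNormEssSup (f := Function.uncurry u)
      (μ := volume.restrict (Icc 0 l ×ˢ Icc 0 τ))
    filter_upwards [h] with z hz
    rw [← eLpNorm_exponent_top] at hz
    have := (ENNReal.toReal_le_toReal (by simp) hu.2.ne).2 hz
    simpa [linfNorm] using this
  have hsub : Ioo 0 l ×ˢ Ioo 0 τ ⊆ Icc 0 l ×ˢ Icc 0 τ :=
    prod_mono Ioo_subset_Icc_self Ioo_subset_Icc_self
  -- Written as an almost everywhere equality of two continuous functions, the bound extends to
  -- every point of the open rectangle.
  have hae' : (fun z => |Function.uncurry u z|) =ᵐ[volume.restrict (Ioo 0 l ×ˢ Ioo 0 τ)]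
      fun z => min |Function.uncurry u z| (linfNorm l τ u) := by
    filter_upwards [ae_restrict_of_ae_restrict_of_subset hsub hae] with z hz
    exact (min_eq_left hz).symm
  have heq := Measure.eqOn_open_of_ae_eq hae' (isOpen_Ioo.prod isOpen_Ioo) hc.abs
    (hc.abs.inf continuousOn_const)
  have := heq (mk_mem_prod hx ht)
  simp only [Function.uncurry_apply_pair] at this
  exact this ▸ min_le_right _ _

theorem abs_uxx_le {l τ : ℝ} (hl : 0 < l) {r : ℕ} {u : ℝ → ℝ → ℝ}
    (hp : PolynomialInX l τ r u) (hu : MemLinf l τ u)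
    (hc : ∀ x ∈ Ioo 0 l, ContinuousOn (fun t => u x t) (Ioo 0 τ)) {x t : ℝ}
    (hx : x ∈ Ioo 0 l) (ht : t ∈ Ioo 0 τ) :
    |uxx u x t| ≤ constL 4 l * (r : ℝ) ^ 4 * linfNorm l τ u := by
  obtain ⟨p, hpr, hpu⟩ := hp t (Ioo_subset_Icc_self ht)
  have hcu := continuousOn_of_polynomialInX hl hp hc
  have hM (y : ℝ) (hy : y ∈ Icc 0 l) : |p.eval y| ≤ linfNorm l τ u := by
    have hcl : IsClosed {y | |p.eval y| ≤ linfNorm l τ u} :=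
      isClosed_le p.continuous.abs continuous_const
    refine closure_minimal (fun y hy => ?_) hcl (closure_Ioo hl.ne ▸ hy)
    rw [mem_ofPred_eq, ← hpu y (Ioo_subset_Icc_self hy)]
    exact abs_le_linfNorm hu hcu hy ht
  have h1 : ∀ y ∈ Ioo 0 l, deriv (fun z => u z t) y = (derivative p).eval y := by
    intro y hy
    have : (fun z => u z t) =ᶠ[nhds y] fun z => p.eval z :=
      Filter.eventually_of_mem (isOpen_Ioo.mem_nhds hy) fun z hz => hpu z (Ioo_subset_Icc_self hz)
    rw [this.deriv_eq, Polynomial.deriv]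
  have h2 : uxx u x t = (derivative (derivative p)).eval x := by
    have : (fun y => deriv (fun z => u z t) y) =ᶠ[nhds x] fun y => (derivative p).eval y :=
      Filter.eventually_of_mem (isOpen_Ioo.mem_nhds hx) h1
    rw [uxx, this.deriv_eq, Polynomial.deriv]
  rw [h2]
  exact abs_second_derivative_eval_le hpr hl hM (Ioo_subset_Icc_self hx)

theorem abs_discreteCoeff_le_of_solvesTelegraph {l τ β₁ β₂ α : ℝ} {f : ℝ → ℝ → ℝ}
    {g₁ g₂ h₁ h₂ : ℝ → ℝ} {u : ℝ → ℝ → ℝ} {r : ℕ} (hl : 0 < l) (hτ : 0 < τ)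
    (hα : -(1 / 2) < α) (hs : SolvesTelegraph l τ β₁ β₂ f g₁ g₂ h₁ h₂ u)
    (hp : PolynomialInX l τ r u) (hu : MemLinf l τ u) {Nx Nt n m : ℕ} (hn : n ≤ Nx)
    (hm : m ≤ Nt) :
    |discreteCoeff l τ α Nx Nt u n m| ≤
      constL 4 l * (r : ℝ) ^ 4 * linfNorm l τ u * √(normRatio α n) * √(normRatio α m) := by
  refine abs_discreteCoeff_le hl hτ hα hn hm (fun x hx t ht => abs_uxx_le hl hp hu
    (fun x hx t ht => (hs.diff_t x hx t ht).continuousAt.continuousWithinAt) hx ht) ?_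
  have : 0 ≤ constL 4 l := by rw [constL]; positivity
  have : 0 ≤ linfNorm l τ u := ENNReal.toReal_nonneg
  positivity

/-! ### The ratio of the squared norms -/

theorem normRatio_zero {α : ℝ} (hα : -(1 / 2) < α) : normRatio α 0 = 1 :=
  div_self (gegenbauerNormSq_pos hα 0).ne'

theorem normRatio_one {α : ℝ} (hα : -(1 / 2) < α) : normRatio α 1 = 2 * (1 + α) := by
  rw [normRatio, ← gegenbauerNormSq_one hα, mul_div_cancel_right₀ _ (gegenbauerNormSq_pos hα 1).ne']

theorem normRatio_succ {α : ℝ} (hα : -(1 / 2) < α) (n : ℕ) :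
    (n + 1 + α) * (n + 2) * normRatio α (n + 2) =
      (n + 1 + 2 * α) * (n + 2 + α) * normRatio α (n + 1) := by
  have h := gegenbauerNormSq_succ hα n
  have h1 := (gegenbauerNormSq_pos hα (n + 1)).ne'
  have h2 := (gegenbauerNormSq_pos hα (n + 2)).ne'
  simp only [normRatio]
  field_simp
  linear_combination -gegenbauerNormSq α 0 * h

theorem normRatio_add_two {α : ℝ} (hα : -(1 / 2) < α) {n : ℕ} (hn : 1 ≤ n) :
    normRatio α (n + 2) = (n + 2 + α) * (n + 1 + 2 * α) * (n + 2 * α) /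
      ((n + 1) * (n + 2) * (n + α)) * normRatio α n := by
  obtain ⟨n, rfl⟩ : ∃ m, n = m + 1 := ⟨n - 1, by omega⟩
  have hn : (0 : ℝ) ≤ n := n.cast_nonneg
  have h1 := normRatio_succ hα n
  have h2 := normRatio_succ hα (n + 1)
  have ha : (n : ℝ) + 1 + α ≠ 0 := by linarith
  have hb : (n : ℝ) + 1 + 1 + α ≠ 0 := by linarith
  push_cast at h2 ⊢
  rw [div_mul_eq_mul_div, eq_div_iff (by positivity)]
  apply mul_left_cancel₀ hb
  linear_combination (n + 1 + 1) * (n + 1 + α) * h2 +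
    (n + 1 + 1 + 2 * α) * (n + 1 + 2 + α) * h1

/-- This permits replacing √R_n by R_n, which is the form of the stated bound for α ≥ 0. -/
theorem one_le_normRatio {α : ℝ} (hα : 0 ≤ α) (n : ℕ) : 1 ≤ normRatio α n := by
  have hα' : -(1 / 2) < α := by linarith
  rcases n with _ | n
  · rw [normRatio_zero hα']
  · induction n with
    | zero => rw [normRatio_one hα']; linarith
    | succ n ih =>
      have hn : (0 : ℝ) ≤ n := n.cast_nonneg
      have h := normRatio_succ hα' n
      have hp : 0 < ((n : ℝ) + 1 + α) * (n + 2) := by positivity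
      refine le_of_mul_le_mul_left ?_ hp
      rw [h, mul_one]
      refine le_trans ?_ (le_mul_of_one_le_right (by positivity) ih)
      nlinarith [mul_nonneg hn hα]

theorem normRatio_eq_gamma {α : ℝ} (hα : 0 ≤ α) (n : ℕ) :
    normRatio α n = 2 * gammaTerm α n / (Real.Gamma (2 * α + 1) * Real.Gamma (n + 1)) := by
  have hα' : -(1 / 2) < α := by linarith
  have hG : Real.Gamma (2 * α + 1) ≠ 0 := (Real.Gamma_pos_of_pos (by linarith)).ne'
  rcases n with _ | n
  · rw [normRatio_zero hα', gammaTerm]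
    rcases eq_or_lt_of_le hα with rfl | h
    · simp
    · have := Real.Gamma_add_one (s := 2 * α) (by positivity)
      rw [if_neg (fun h' => h.ne' h'.1)]
      have hg : Real.Gamma (2 * α) ≠ 0 := (Real.Gamma_pos_of_pos (by linarith)).ne'
      simp only [Nat.cast_zero, zero_add, Real.Gamma_one, mul_one, this]
      field_simp
  · rw [gammaTerm, if_neg (fun h' => n.succ_ne_zero h'.2)]
    induction n with
    | zero =>
      rw [normRatio_one hα']
      have : Real.Gamma (2 * α + 1) = Real.Gamma (1 + 2 * α) := by rw [add_comm]
      rw [this] at hG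
      simp only [zero_add, Nat.cast_one, this, one_add_one_eq_two, Real.Gamma_two]
      field_simp
    | succ n ih =>
      have hn : (0 : ℝ) ≤ n := n.cast_nonneg
      have h := normRatio_succ hα' n
      have e1 : Real.Gamma ((n + 1 + 1 : ℕ) + 2 * α) =
          (n + 1 + 2 * α) * Real.Gamma ((n + 1 : ℕ) + 2 * α) := by
        rw [show ((n + 1 + 1 : ℕ) : ℝ) + 2 * α = (n + 1 : ℕ) + 2 * α + 1 by push_cast; ring,
          Real.Gamma_add_one (by positivity)]
        push_cast; rfl
      have e2 : Real.Gamma ((n + 1 + 1 : ℕ) + 1) = (n + 2) * Real.Gamma ((n + 1 : ℕ) + 1) := by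
        rw [show ((n + 1 + 1 : ℕ) : ℝ) + 1 = (n + 1 : ℕ) + 1 + 1 by push_cast; ring,
          Real.Gamma_add_one (by positivity)]
        push_cast; ring
      have hg : Real.Gamma ((n + 1 : ℕ) + 1) ≠ 0 :=
        (Real.Gamma_pos_of_pos (by positivity)).ne'
      rw [ih] at h
      rw [e1, e2]
      have hp : ((n : ℝ) + 1 + α) * (n + 2) ≠ 0 := by positivity
      apply mul_left_cancel₀ hp
      rw [h]
      push_cast
      field_simp
      ring

/-! ### Parity bounds on the ratio for -1/2 < α < 0 -/

theorem halfBinom_zero (α : ℝ) : halfBinom α 0 = 1 := by simp [halfBinom]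

theorem factorial_mul_halfBinom (α : ℝ) (k : ℕ) :
    (k.factorial : ℝ) * halfBinom α (2 * k) = (ascPochhammer ℝ k).eval α := by
  have h := Ring.factorial_nsmul_multichoose_eq_ascPochhammer α k
  rw [Ring.multichoose_eq, ascPochhammer_smeval_eq_eval, nsmul_eq_mul] at h
  rw [halfBinom, ← h, Nat.mul_div_cancel_left k two_pos]
  congr 3
  push_cast
  ring

theorem halfBinom_succ (α : ℝ) (k : ℕ) :
    halfBinom α (2 * (k + 1)) = (α + k) / (k + 1) * halfBinom α (2 * k) := by
  have h1 := factorial_mul_halfBinom α k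
  have h2 := factorial_mul_halfBinom α (k + 1)
  rw [ascPochhammer_succ_right, eval_mul, ← h1, Nat.factorial_succ] at h2
  have hk : (k.factorial : ℝ) ≠ 0 := by positivity
  simp only [eval_add, eval_X, eval_natCast] at h2
  push_cast at h2
  rw [div_mul_eq_mul_div, eq_div_iff (by positivity)]
  apply mul_left_cancel₀ hk
  linear_combination h2

theorem even_step_polynomial_le {x α : ℝ} (hx : 2 ≤ x) (hα : -(1 / 2) < α) (hα0 : α < 0) :
    (x + 2) ^ 2 * (x - 1) * (x + 1 + 2 * α) * (x + α) ≤
      x * (x + 1) ^ 2 * (x + 2 + α) * (x + 2 * α) := by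
  have e : x * (x + 1) ^ 2 * (x + 2 + α) * (x + 2 * α) -
      (x + 2) ^ 2 * (x - 1) * (x + 1 + 2 * α) * (x + α) =
      2 * ((x + 1) * (x + 2 + α) * (x + 2 * α) - (x + 2) * (x - 1) * (α * (α - 1))) := by ring
  have h1 : α * (α - 1) ≤ 1 := by nlinarith
  have h2 : (x + 1) * (x - 1) ≤ (x + 2 + α) * (x + 2 * α) :=
    mul_le_mul (by linarith) (by linarith) (by linarith) (by linarith)
  have h3 : (x + 2) * (x - 1) * (α * (α - 1)) ≤ (x + 2) * (x - 1) :=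
    mul_le_of_le_one_right (mul_nonneg (by linarith) (by linarith)) h1
  nlinarith [mul_le_mul_of_nonneg_left h2 (by linarith : 0 ≤ x + 1),
    mul_nonneg (by linarith : 0 ≤ x - 1) (by nlinarith : 0 ≤ (x + 1) ^ 2 - (x + 2))]

/-- With n = 2k + 2 and B_n the claimed bound for √R_n, the induction runs on n R_n ≤ (n - 1) B_n².
The plain R_n ≤ B_n² is not inductive: its step would need a polynomial inequality that fails by
2α(1 - α) < 0. The increase of (n - 1)/n makes up for this, and `even_step_polynomial_le` is the
resulting step. -/
theorem normRatio_even_aux {α : ℝ} (hα : -(1 / 2) < α) (hα0 : α < 0) (k : ℕ) :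
    (2 * k + 2) * normRatio α (2 * (k + 1)) ≤
      (2 * k + 1) * ((2 * k + 2 + α) / α * halfBinom α (2 * (k + 1))) ^ 2 := by
  induction k with
  | zero =>
    have h := normRatio_succ hα 0
    rw [normRatio_one hα] at h
    have hb := halfBinom_succ α 0
    rw [mul_zero, halfBinom_zero] at hb
    have hα1 : 1 + α ≠ 0 := by linarith
    have h2 : normRatio α 2 = (1 + 2 * α) * (2 + α) := by
      apply mul_left_cancel₀ (mul_ne_zero hα1 two_ne_zero)
      push_cast at h
      simp only [zero_add] at h
      linear_combination h
    simp only [zero_add, mul_one] at hb ⊢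
    rw [h2, hb]
    have hne := hα0.ne
    have e : (2 * ((0 : ℕ) : ℝ) + 2 + α) / α * ((α + (0 : ℕ)) / ((0 : ℕ) + 1)) = 2 + α := by
      push_cast; field_simp; ring
    rw [e]
    push_cast
    nlinarith
  | succ k ih =>
    have hk : (0 : ℝ) ≤ k := k.cast_nonneg
    have hR := normRatio_add_two hα (n := 2 * (k + 1)) (by omega)
    have hB := halfBinom_succ α (k + 1)
    rw [show 2 * (k + 1) + 2 = 2 * (k + 1 + 1) by ring] at hR
    rw [hR, hB]
    set R := normRatio α (2 * (k + 1))
    set b := halfBinom α (2 * (k + 1))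
    push_cast
    obtain ⟨x, hx⟩ : ∃ x : ℝ, x = 2 * k + 2 := ⟨_, rfl⟩
    have hkx : (k : ℝ) = (x - 2) / 2 := by linarith
    have hx2 : 2 ≤ x := by linarith
    rw [hkx] at ih ⊢
    have hne := hα0.ne
    have p1 : 0 < x + α := by linarith
    have p2 : 0 < x + 2 * α := by linarith
    have p3 : 0 < x + 1 + 2 * α := by linarith
    have p4 : 0 < x + 2 + α := by linarith
    have p0 : 0 < x := by linarith
    have hpoly := even_step_polynomial_le hx2 hα hα0
    have e1 : (2 * ((x - 2) / 2 + 1) + 2) * ((2 * ((x - 2) / 2 + 1) + 2 + α) *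
        (2 * ((x - 2) / 2 + 1) + 1 + 2 * α) * (2 * ((x - 2) / 2 + 1) + 2 * α) /
        ((2 * ((x - 2) / 2 + 1) + 1) * (2 * ((x - 2) / 2 + 1) + 2) *
        (2 * ((x - 2) / 2 + 1) + α)) * R) =
        (x + 2 + α) * (x + 1 + 2 * α) * (x + 2 * α) / (x * (x + 1) * (x + α)) * (x * R) := by
      rw [show 2 * ((x - 2) / 2 + 1) = x by ring]
      field_simp
    have e2 : (2 * ((x - 2) / 2 + 1) + 1) * ((2 * ((x - 2) / 2 + 1) + 2 + α) / α *
        ((α + ((x - 2) / 2 + 1)) / ((x - 2) / 2 + 1 + 1) * b)) ^ 2 =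
        (x + 1) * ((x + 2 + α) * (x + 2 * α)) ^ 2 / ((x + α) * (x + 2)) ^ 2 *
          ((x + α) / α * b) ^ 2 := by
      rw [show 2 * ((x - 2) / 2 + 1) = x by ring,
        show α + ((x - 2) / 2 + 1) = (x + 2 * α) / 2 by ring,
        show (x - 2) / 2 + 1 + 1 = (x + 2) / 2 by ring]
      field_simp
    rw [show 2 * ((x - 2) / 2) = x - 2 by ring, show x - 2 + 2 = x by ring,
      show x - 2 + 1 = x - 1 by ring] at ih
    rw [e1, e2]
    refine (mul_le_mul_of_nonneg_left ih (by positivity)).trans ?_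
    rw [← mul_assoc]
    refine mul_le_mul_of_nonneg_right ?_ (sq_nonneg _)
    rw [div_mul_eq_mul_div, div_le_div_iff₀ (by positivity) (by positivity)]
    have hq : 0 ≤ (x + 2 + α) * (x + 2 * α) * (x + α) := by positivity
    linear_combination mul_le_mul_of_nonneg_left hpoly hq

theorem normRatio_le_of_even {α : ℝ} (hα : -(1 / 2) < α) (hα0 : α < 0) {n : ℕ} (hn : Even n) :
    √(normRatio α n) ≤ |(n + α) / α * halfBinom α n| := by
  apply Real.sqrt_le_sqrt (y := ((n + α) / α * halfBinom α n) ^ 2) ?_ |>.trans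
    (Real.sqrt_sq_eq_abs _).le
  obtain ⟨k, rfl⟩ := even_iff_exists_two_mul.1 hn
  rcases k with _ | k
  · simp [normRatio_zero hα, halfBinom_zero, hα0.ne]
  · have hk : (0 : ℝ) ≤ k := k.cast_nonneg
    have h := normRatio_even_aux hα hα0 k
    have e : ((2 * (k + 1) : ℕ) : ℝ) + α = 2 * k + 2 + α := by push_cast; ring
    rw [e]
    refine le_of_mul_le_mul_left (h.trans ?_) (by positivity : (0 : ℝ) < 2 * k + 2)
    exact mul_le_mul_of_nonneg_right (by linarith) (sq_nonneg _)

/-- Here the squared claim is inductive as it stands: the two sides of the polynomial inequality in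
the step differ by -2α(1 + α) > 0. -/
theorem normRatio_odd_aux {α : ℝ} (hα : -(1 / 2) < α) (hα0 : α < 0) (k : ℕ) :
    (2 * k + 1) * (2 * k + 1 + 2 * α) * normRatio α (2 * k + 1) ≤
      (2 * (2 * k + 1 + α) *
        (Real.Gamma (k + 1 + α) / (Real.Gamma (α + 1) * Real.Gamma (k + 1)))) ^ 2 := by
  have hG : Real.Gamma (α + 1) ≠ 0 := (Real.Gamma_pos_of_pos (by linarith)).ne'
  induction k with
  | zero =>
    have e : Real.Gamma ((0 : ℕ) + 1 + α) / (Real.Gamma (α + 1) * Real.Gamma ((0 : ℕ) + 1)) = 1 := by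
      simp only [Nat.cast_zero, zero_add, Real.Gamma_one, mul_one, add_comm 1 α]
      exact div_self hG
    rw [e]
    simp only [mul_zero, zero_add, normRatio_one hα]
    push_cast
    nlinarith
  | succ k ih =>
    have hk : (0 : ℝ) ≤ k := k.cast_nonneg
    have hR := normRatio_add_two hα (n := 2 * k + 1) (by omega)
    rw [show 2 * k + 1 + 2 = 2 * (k + 1) + 1 by ring] at hR
    have g1 : Real.Gamma ((k + 1 : ℕ) + 1 + α) = (k + 1 + α) * Real.Gamma (k + 1 + α) := by
      rw [← Real.Gamma_add_one (by linarith)]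
      push_cast; congr 1; ring
    have g2 : Real.Gamma ((k + 1 : ℕ) + 1) = (k + 1) * Real.Gamma (k + 1) := by
      rw [← Real.Gamma_add_one (by positivity)]
      push_cast; rfl
    have hg : Real.Gamma ((k : ℝ) + 1) ≠ 0 := (Real.Gamma_pos_of_pos (by positivity)).ne'
    have eg : Real.Gamma ((k + 1 : ℕ) + 1 + α) / (Real.Gamma (α + 1) * Real.Gamma ((k + 1 : ℕ) + 1))
        = (k + 1 + α) / (k + 1) *
          (Real.Gamma (k + 1 + α) / (Real.Gamma (α + 1) * Real.Gamma (k + 1))) := by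
      rw [g1, g2]; field_simp
    rw [eg, hR]
    set R := normRatio α (2 * k + 1)
    set g := Real.Gamma (k + 1 + α) / (Real.Gamma (α + 1) * Real.Gamma (k + 1))
    push_cast
    obtain ⟨x, hx⟩ : ∃ x : ℝ, x = 2 * k + 1 := ⟨_, rfl⟩
    have hkx : (k : ℝ) = (x - 1) / 2 := by linarith
    have hx1 : 1 ≤ x := by linarith
    have p1 : 0 < x + α := by linarith
    have p2 : 0 < x + 2 * α := by linarith
    have p3 : 0 < x + 1 + 2 * α := by linarith
    have p4 : 0 < x + 2 + α := by linarith
    have p5 : 0 < x + 2 + 2 * α := by linarith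
    have p0 : 0 < x := by linarith
    rw [← hx] at ih ⊢
    have e1 : (2 * ((k : ℝ) + 1) + 1) * (2 * ((k : ℝ) + 1) + 1 + 2 * α) *
        ((x + 2 + α) * (x + 1 + 2 * α) * (x + 2 * α) / ((x + 1) * (x + 2) * (x + α)) * R) =
        (x + 2 + α) * (x + 1 + 2 * α) * (x + 2 + 2 * α) / ((x + 1) * x * (x + α)) *
          (x * (x + 2 * α) * R) := by
      rw [show 2 * ((k : ℝ) + 1) + 1 = x + 2 by rw [hx]; ring]
      field_simp
    have e2 : (2 * (2 * ((k : ℝ) + 1) + 1 + α) * (((k : ℝ) + 1 + α) / (k + 1) * g)) ^ 2 =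
        ((x + 2 + α) * (x + 1 + 2 * α)) ^ 2 / ((x + α) * (x + 1)) ^ 2 *
          (2 * (x + α) * g) ^ 2 := by
      rw [show 2 * ((k : ℝ) + 1) + 1 = x + 2 by rw [hx]; ring,
        show (k : ℝ) + 1 + α = (x + 1 + 2 * α) / 2 by rw [hx]; ring,
        show (k : ℝ) + 1 = (x + 1) / 2 by rw [hx]; ring]
      field_simp
    rw [e1, e2]
    refine (mul_le_mul_of_nonneg_left ih (by positivity)).trans ?_
    refine mul_le_mul_of_nonneg_right ?_ (sq_nonneg _)
    rw [div_le_div_iff₀ (by positivity) (by positivity)]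
    have hpoly : (x + α) * (x + 2 + 2 * α) * (x + 1) ≤ x * (x + 2 + α) * (x + 1 + 2 * α) := by
      nlinarith
    have hq : 0 ≤ (x + 2 + α) * (x + 1 + 2 * α) * (x + α) * (x + 1) := by positivity
    linear_combination mul_le_mul_of_nonneg_left hpoly hq

theorem normRatio_le_of_not_even {α : ℝ} (hα : -(1 / 2) < α) (hα0 : α < 0) {n : ℕ}
    (hn : ¬ Even n) :
    √(normRatio α n) ≤ 2 * |n + α| * Real.Gamma (((n : ℝ) + 1) / 2 + α) /
      (Real.Gamma (α + 1) * Real.Gamma (((n : ℝ) + 1) / 2) * √(n * (n + 2 * α))) := by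
  obtain ⟨k, rfl⟩ := Nat.not_even_iff_odd.1 hn
  have hk : (0 : ℝ) ≤ k := k.cast_nonneg
  have h := normRatio_odd_aux hα hα0 k
  have e1 : (((2 * k + 1 : ℕ) : ℝ) + 1) / 2 = k + 1 := by push_cast; ring
  have e2 : ((2 * k + 1 : ℕ) : ℝ) = 2 * k + 1 := by push_cast; ring
  rw [e1, e2]
  have p1 : (0 : ℝ) < 2 * k + 1 + α := by linarith
  have p2 : (0 : ℝ) < 2 * k + 1 + 2 * α := by linarith
  have g1 : 0 < Real.Gamma (α + 1) := Real.Gamma_pos_of_pos (by linarith)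
  have g2 : 0 < Real.Gamma ((k : ℝ) + 1) := Real.Gamma_pos_of_pos (by linarith)
  have g3 : 0 < Real.Gamma ((k : ℝ) + 1 + α) := Real.Gamma_pos_of_pos (by linarith)
  have hq : (0 : ℝ) < (2 * k + 1) * (2 * k + 1 + 2 * α) := by positivity
  rw [abs_of_pos p1, le_div_iff₀ (by positivity)]
  have hs := Real.sqrt_le_sqrt h
  rw [Real.sqrt_mul hq.le, Real.sqrt_sq (by positivity)] at hs
  have := mul_le_mul_of_nonneg_right hs (mul_pos g1 g2).le
  have e3 : 2 * (2 * (k : ℝ) + 1 + α) * (Real.Gamma (k + 1 + α) /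
      (Real.Gamma (α + 1) * Real.Gamma (k + 1))) * (Real.Gamma (α + 1) * Real.Gamma (k + 1)) =
      2 * (2 * k + 1 + α) * Real.Gamma (k + 1 + α) := by
    field_simp
  rw [e3] at this
  linarith

/-! ### Asymptotics of the ratio -/

/-- The product is the denominator of Euler's sequence `Real.GammaSeq (2 * α) n`, which makes the
asymptotics of R_n immediate. Clearing denominators keeps the induction free of division by α. -/
theorem normRatio_mul_factorial {α : ℝ} (hα : -(1 / 2) < α) (n : ℕ) :
    α * normRatio α n * (n + 2 * α) * n.factorial =
      (n + α) * ∏ j ∈ Finset.range (n + 1), (2 * α + j) := by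
  rcases n with _ | n
  · simp [normRatio_zero hα]
  · induction n with
    | zero =>
      rw [normRatio_one hα, Finset.prod_range_succ, Finset.prod_range_one]
      simp; ring
    | succ n ih =>
      have hn : (0 : ℝ) ≤ n := n.cast_nonneg
      have h := normRatio_succ hα n
      have ha : (n : ℝ) + 1 + α ≠ 0 := by linarith
      rw [Finset.prod_range_succ, Nat.factorial_succ]
      push_cast at ih ⊢
      apply mul_left_cancel₀ ha
      linear_combination α * (n + 1 + 1 + 2 * α) * (n + 1).factorial * h +
        (n + 2 + α) * (n + 1 + 1 + 2 * α) * ih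

theorem tendsto_normRatio_div_rpow {α : ℝ} (hα : -(1 / 2) < α) (hα0 : α ≠ 0) :
    Filter.Tendsto (fun n : ℕ => normRatio α n / (n : ℝ) ^ (2 * α)) Filter.atTop
      (nhds (1 / α * 1 / Real.Gamma (2 * α))) := by
  have hG : Real.Gamma (2 * α) ≠ 0 := by
    refine Real.Gamma_ne_zero fun m hm => ?_
    rcases m with _ | m
    · simp at hm; exact hα0 hm
    · have : (0 : ℝ) ≤ m := m.cast_nonneg
      push_cast at hm
      linarith
  have h1 : Filter.Tendsto (fun n : ℕ => ((n : ℝ) + α) / (n + 2 * α)) Filter.atTop (nhds 1) := by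
    have := tendsto_add_mul_div_add_mul_atTop_nhds α (2 * α) 1 (one_ne_zero (α := ℝ))
    simpa [add_comm] using this
  refine ((h1.const_mul (1 / α)).div (Real.GammaSeq_tendsto_Gamma (2 * α)) hG).congr' ?_
  filter_upwards [Filter.eventually_ge_atTop 1] with n hn
  have hn' : (1 : ℝ) ≤ n := by exact_mod_cast hn
  have h := normRatio_mul_factorial hα n
  have p0 : (0 : ℝ) < n := by linarith
  have p1 : (n : ℝ) + 2 * α ≠ 0 := by linarith
  have p3 : (n : ℝ) ^ (2 * α) ≠ 0 := by positivity
  have p4 : (n.factorial : ℝ) ≠ 0 := by positivity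
  have p2 : ∏ j ∈ Finset.range (n + 1), (2 * α + j) ≠ 0 := by
    refine Finset.prod_ne_zero_iff.2 fun j _ => ?_
    rcases j with _ | j
    · simpa using hα0
    · have : (0 : ℝ) ≤ j := j.cast_nonneg
      push_cast
      linarith
  simp only [Pi.div_apply, Real.GammaSeq]
  generalize ∏ j ∈ Finset.range (n + 1), (2 * α + (j : ℝ)) = P at h p2 ⊢
  generalize (n : ℝ) + 2 * α = d at h p1 ⊢
  field_simp
  linear_combination -h

theorem constD₁_pos {α : ℝ} (hα : -(1 / 2) < α) : 0 < constD₁ α := by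
  have h1 := Real.Gamma_pos_of_pos (by linarith : 0 < α + 1 / 2)
  have h2 := Real.Gamma_pos_of_pos (by linarith : 0 < α + 1)
  rw [constD₁]
  positivity

/-- At α = 0 the constant is 8π/e², and R_n = 2 for n ≥ 1. This is the only case of α ≥ 0 in which
the size of D₁ matters. -/
theorem two_le_constD₁_zero : 2 ≤ constD₁ 0 := by
  have he : Real.exp 1 < 3 := Real.exp_one_lt_three
  have h2 : Real.exp 2 = Real.exp 1 ^ 2 := by rw [← Real.exp_nat_mul]; norm_num
  have h9 : Real.exp 1 ^ 2 < 9 := by nlinarith [Real.exp_pos 1]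
  have hpi := Real.pi_gt_three
  rw [constD₁]
  have e1 : (2 : ℝ) ^ (3 - 4 * 0 : ℝ) = 8 := by
    rw [mul_zero, sub_zero]; norm_num
  have e2 : Real.exp (-4 * 0 - 2) = (Real.exp 2)⁻¹ := by rw [← Real.exp_neg]; norm_num
  rw [e1, e2, zero_add, zero_add, Real.Gamma_one_half_eq, Real.Gamma_one,
    Real.sq_sqrt Real.pi_pos.le, h2, one_pow, mul_one, le_div_iff₀ Real.pi_pos,
    ← div_eq_mul_inv, le_div_iff₀ (by positivity)]
  nlinarith [Real.pi_pos, mul_pos Real.pi_pos (by linarith : 0 < 9 - Real.exp 1 ^ 2)]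

theorem normRatio_zero_param (n : ℕ) : normRatio 0 (n + 1) = 2 := by
  have h0 : (-(1 / 2) : ℝ) < 0 := by norm_num
  induction n with
  | zero => rw [normRatio_one h0]; norm_num
  | succ n ih =>
    have h := normRatio_succ h0 n
    have hp : ((n : ℝ) + 1 + 0) * (n + 2) ≠ 0 := by positivity
    apply mul_left_cancel₀ hp
    rw [h, ih]; ring

theorem eventually_normRatio_le_of_nonneg {α : ℝ} (hα : 0 ≤ α) :
    ∀ᶠ n : ℕ in Filter.atTop, normRatio α n ≤ constD₁ α * ((n : ℝ) ^ (2 * α)) ^ 2 := by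
  rcases eq_or_lt_of_le hα with rfl | h
  · filter_upwards [Filter.eventually_ge_atTop 1] with n hn
    obtain ⟨n, rfl⟩ : ∃ m, n = m + 1 := ⟨n - 1, by omega⟩
    rw [normRatio_zero_param]
    simpa using two_le_constD₁_zero
  · have hα' : -(1 / 2) < α := by linarith
    -- For α > 0 the claim allows n^{4α} while R_n grows like n^{2α}, so any positive constant
    -- eventually suffices.
    have h1 := tendsto_normRatio_div_rpow hα' h.ne'
    have h2 : Filter.Tendsto (fun n : ℕ => ((n : ℝ) ^ (2 * α))⁻¹) Filter.atTop (nhds 0) :=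
      ((tendsto_rpow_atTop (by positivity : 0 < 2 * α)).comp
        tendsto_natCast_atTop_atTop).inv_tendsto_atTop
    have h3 := h1.mul h2
    rw [mul_zero] at h3
    filter_upwards [h3.eventually_lt_const (constD₁_pos hα'), Filter.eventually_ge_atTop 1]
      with n hn hn1
    have p0 : (0 : ℝ) < n := by exact_mod_cast hn1
    have p1 : 0 < (n : ℝ) ^ (2 * α) := by positivity
    rw [← div_le_iff₀ (by positivity)]
    refine le_trans (le_of_eq ?_) hn.le
    field_simp

theorem eventually_normRatio_le_of_neg {α : ℝ} (hα : -(1 / 2) < α) (hα0 : α < 0) :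
    ∃ A : ℝ, 1 < A ∧ ∀ᶠ n : ℕ in Filter.atTop,
      normRatio α n ≤ A ^ 2 * constD₁ α * ((n : ℝ) ^ α) ^ 2 := by
  have h1 := tendsto_normRatio_div_rpow hα hα0.ne
  set c := 1 / α * 1 / Real.Gamma (2 * α)
  have hD := constD₁_pos hα
  -- This A exceeds 1, so A² ≥ A and A² D₁ ≥ |c| + 1, which is above the limit c of R_n/n^{2α}.
  refine ⟨2 + (|c| + 1) / constD₁ α, by linarith [div_pos (by positivity : 0 < |c| + 1) hD], ?_⟩
  filter_upwards [h1.eventually_lt_const (lt_of_le_of_lt (le_abs_self c) (lt_add_one |c|)),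
    Filter.eventually_ge_atTop 1] with n hn hn1
  have p0 : (0 : ℝ) < n := by exact_mod_cast hn1
  have e : ((n : ℝ) ^ α) ^ 2 = (n : ℝ) ^ (2 * α) := by
    rw [← Real.rpow_natCast, ← Real.rpow_mul p0.le]; congr 1; push_cast; ring
  rw [div_lt_iff₀ (by positivity)] at hn
  rw [e]
  refine hn.le.trans (mul_le_mul_of_nonneg_right ?_ (by positivity))
  have hq : 0 < (|c| + 1) / constD₁ α := by positivity
  calc |c| + 1 = (|c| + 1) / constD₁ α * constD₁ α := by field_simp
    _ ≤ _ := mul_le_mul_of_nonneg_right (by nlinarith) hD.le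

/-! ### Assembling the estimates -/

theorem mul_sqrt_normRatio_le {α : ℝ} {n m : ℕ} {B a b : ℝ} (hB : 0 ≤ B)
    (ha : √(normRatio α n) ≤ a) (hb : √(normRatio α m) ≤ b) :
    B * √(normRatio α n) * √(normRatio α m) ≤ B * a * b :=
  mul_le_mul (mul_le_mul_of_nonneg_left ha hB) hb (Real.sqrt_nonneg _)
    (mul_nonneg hB ((Real.sqrt_nonneg _).trans ha))

theorem sqrt_normRatio_le_gamma {α : ℝ} (hα : 0 ≤ α) (n : ℕ) :
    √(normRatio α n) ≤ 2 * gammaTerm α n / (Real.Gamma (2 * α + 1) * Real.Gamma (n + 1)) := by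
  rw [← normRatio_eq_gamma hα]
  have h := one_le_normRatio hα n
  exact Real.sqrt_le_iff.2 ⟨by linarith, by nlinarith⟩

theorem sqrt_normRatio_le_of_sq {α D : ℝ} {n : ℕ} {p : ℝ} (hp : 0 ≤ p)
    (h : normRatio α n ≤ D * p ^ 2) : √(normRatio α n) ≤ √D * p := by
  refine (Real.sqrt_le_sqrt h).trans ?_
  rw [Real.sqrt_mul' _ (sq_nonneg p), Real.sqrt_sq hp]

theorem sqrt_sqrt_mul_eq {x y : ℝ} (hx : 0 ≤ x) (hy : 0 ≤ y) :
    (x ^ 2 * y ^ 2) ^ (1 / 4 : ℝ) = √x * √y := by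
  rw [Real.sqrt_eq_rpow, Real.sqrt_eq_rpow, ← mul_pow, ← Real.rpow_natCast,
    ← Real.rpow_mul (mul_nonneg hx hy), ← Real.mul_rpow hx hy]
  norm_num

theorem exists_normRatio_bounds {α : ℝ} (hα : -(1 / 2) < α) :
    ∃ A : ℝ, 1 < A ∧ ∃ K : ℕ, ∀ n : ℕ, K ≤ n →
      (0 ≤ α → √(normRatio α n) ≤ √(constD₁ α) * (n : ℝ) ^ (2 * α)) ∧
      (α < 0 → √(normRatio α n) ≤ √(A ^ 2 * constD₁ α) * (n : ℝ) ^ α) := by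
  rcases le_or_gt 0 α with h | h
  · obtain ⟨K, hK⟩ := Filter.eventually_atTop.1 (eventually_normRatio_le_of_nonneg h)
    exact ⟨2, one_lt_two, K, fun n hn =>
      ⟨fun _ => sqrt_normRatio_le_of_sq (by positivity) (hK n hn), fun h' => absurd h' h.not_gt⟩⟩
  · obtain ⟨A, hA, hev⟩ := eventually_normRatio_le_of_neg hα h
    obtain ⟨K, hK⟩ := Filter.eventually_atTop.1 hev
    exact ⟨A, hA, K, fun n hn => ⟨fun h' => absurd h' h.not_ge,
      fun _ => sqrt_normRatio_le_of_sq (by positivity) (hK n hn)⟩⟩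

theorem mixed_parity_bound_eq {α c : ℝ} (hα0 : α ≠ 0) (a b h g k s : ℝ)
    (hG : Real.Gamma (α + 1) = |α| * |Real.Gamma α|) :
    c * |(a + α) / α * h| * (2 * |b + α| * g / (Real.Gamma (α + 1) * k * s)) =
      2 * c * g * |(a + α) * (b + α)| / (α ^ 2 * s * k * |Real.Gamma α|) * |h| := by
  rw [hG, abs_mul, abs_div, abs_mul (a + α), ← sq_abs α]
  have := abs_pos.2 hα0
  field_simp

end

theorem mainTheorem10 :
    ∃ C : ℝ, 0 < C ∧ ∀ α : ℝ, -(1 / 2) < α →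
    ∃ A₁ A₂ : ℝ, 1 < A₁ ∧ 1 < A₂ ∧ ∃ K : ℕ,
    ∀ (l τ β₁ β₂ : ℝ) (f : ℝ → ℝ → ℝ) (g₁ g₂ h₁ h₂ : ℝ → ℝ) (u : ℝ → ℝ → ℝ) (r : ℕ),
    0 < l → 0 < τ → 1 ≤ r →
    SolvesTelegraph l τ β₁ β₂ f g₁ g₂ h₁ h₂ u → PolynomialInX l τ r u → MemLinf l τ u →
    ∀ Nx Nt n m : ℕ, n ≤ Nx → m ≤ Nt →
      (0 ≤ α →
        |discreteCoeff l τ α Nx Nt u n m| ≤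
          4 * constL C l * (r : ℝ) ^ 4 * gammaTerm α n * gammaTerm α m /
            (Real.Gamma (2 * α + 1) ^ 2 * Real.Gamma (n + 1) * Real.Gamma (m + 1)) *
            linfNorm l τ u) ∧
      (α < 0 → Even n → Even m →
        |discreteCoeff l τ α Nx Nt u n m| ≤
          constL C l * (r : ℝ) ^ 4 * |(n + α) * (m + α)| / α ^ 2 *
            |halfBinom α n * halfBinom α m| * linfNorm l τ u) ∧
      (α < 0 → ¬ Even n → ¬ Even m →
        |discreteCoeff l τ α Nx Nt u n m| ≤
          4 * constL C l * (r : ℝ) ^ 4 * |(n + α) * (m + α)| *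
            Real.Gamma (((n : ℝ) + 1) / 2 + α) * Real.Gamma (((m : ℝ) + 1) / 2 + α) /
            (Real.Gamma (α + 1) ^ 2 * Real.Gamma (((n : ℝ) + 1) / 2) *
              Real.Gamma (((m : ℝ) + 1) / 2) *
              ((n : ℝ) ^ 2 * (m : ℝ) ^ 2 * (n + 2 * α) ^ 2 * (m + 2 * α) ^ 2) ^ (1 / 4 : ℝ)) *
            linfNorm l τ u) ∧
      (α < 0 → Even n → ¬ Even m →
        |discreteCoeff l τ α Nx Nt u n m| ≤
          2 * constL C l * (r : ℝ) ^ 4 * Real.Gamma (((m : ℝ) + 1) / 2 + α) *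
            |(n + α) * (m + α)| /
            (α ^ 2 * Real.sqrt (m * (m + 2 * α)) * Real.Gamma (((m : ℝ) + 1) / 2) *
              |Real.Gamma α|) *
            |halfBinom α n| * linfNorm l τ u) ∧
      (α < 0 → ¬ Even n → Even m →
        |discreteCoeff l τ α Nx Nt u n m| ≤
          2 * constL C l * (r : ℝ) ^ 4 * Real.Gamma (((n : ℝ) + 1) / 2 + α) *
            |(n + α) * (m + α)| /
            (α ^ 2 * Real.sqrt (n * (n + 2 * α)) * Real.Gamma (((n : ℝ) + 1) / 2) *
              |Real.Gamma α|) *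
            |halfBinom α m| * linfNorm l τ u) ∧
      (0 ≤ α → K ≤ n → K ≤ m →
        |discreteCoeff l τ α Nx Nt u n m| ≤
          constL C l * constD₁ α * (r : ℝ) ^ 4 * ((n : ℝ) * m) ^ (2 * α) * linfNorm l τ u) ∧
      (α < 0 → K ≤ n → K ≤ m →
        |discreteCoeff l τ α Nx Nt u n m| ≤
          constL C l * constD₂ A₁ A₂ α * (r : ℝ) ^ 4 * ((n : ℝ) * m) ^ α *
            linfNorm l τ u) := by
  -- C = 4 makes C_l = 16/l², the constant of the second-derivative bound.
  refine ⟨4, by norm_num, fun α hα => ?_⟩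
  obtain ⟨A, hA, K, hK⟩ := exists_normRatio_bounds hα
  -- One factor A comes from each of √R_n and √R_m, so D₂ = A² D₁.
  refine ⟨A, A, hA, hA, K, ?_⟩
  intro l τ β₁ β₂ f g₁ g₂ h₁ h₂ u r hl hτ _ hs hp hu Nx Nt n m hn hm
  have hmain := abs_discreteCoeff_le_of_solvesTelegraph hl hτ hα hs hp hu hn hm
  have hU : 0 ≤ linfNorm l τ u := ENNReal.toReal_nonneg
  have hB : 0 ≤ constL 4 l * (r : ℝ) ^ 4 * linfNorm l τ u := by
    have : 0 ≤ constL 4 l := by rw [constL]; positivity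
    positivity
  have hG (h : α < 0) : Real.Gamma (α + 1) = |α| * |Real.Gamma α| := by
    rw [← abs_mul, ← Real.Gamma_add_one h.ne,
      abs_of_pos (Real.Gamma_pos_of_pos (by linarith))]
  have hD := constD₁_pos hα
  refine ⟨fun h => ?_, fun h hne hme => ?_, fun h hno hmo => ?_, fun h hne hmo => ?_,
    fun h hno hme => ?_, fun h hnK hmK => ?_, fun h hnK hmK => ?_⟩
  · refine (hmain.trans (mul_sqrt_normRatio_le hB (sqrt_normRatio_le_gamma h n)
      (sqrt_normRatio_le_gamma h m))).trans (le_of_eq ?_)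
    have g1 := (Real.Gamma_pos_of_pos (by linarith : 0 < 2 * α + 1)).ne'
    have g2 := (Real.Gamma_pos_of_pos (by positivity : 0 < (n : ℝ) + 1)).ne'
    have g3 := (Real.Gamma_pos_of_pos (by positivity : 0 < (m : ℝ) + 1)).ne'
    field_simp
    ring
  · refine (hmain.trans (mul_sqrt_normRatio_le hB (normRatio_le_of_even hα h hne)
      (normRatio_le_of_even hα h hme))).trans (le_of_eq ?_)
    rw [abs_mul, abs_mul, abs_div, abs_div, abs_mul (n + α), abs_mul (halfBinom α n), ← sq_abs α]
    have := abs_pos.2 h.ne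
    field_simp
  · refine (hmain.trans (mul_sqrt_normRatio_le hB (normRatio_le_of_not_even hα h hno)
      (normRatio_le_of_not_even hα h hmo))).trans (le_of_eq ?_)
    have hx {k : ℕ} (hk : ¬ Even k) : 0 ≤ (k : ℝ) * (k + 2 * α) := by
      have : (1 : ℝ) ≤ k := by
        exact_mod_cast Nat.one_le_iff_ne_zero.2 (by rintro rfl; exact hk Even.zero)
      exact mul_nonneg (by linarith) (by linarith)
    have e : (n : ℝ) ^ 2 * (m : ℝ) ^ 2 * (n + 2 * α) ^ 2 * (m + 2 * α) ^ 2 =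
        (n * (n + 2 * α)) ^ 2 * (m * (m + 2 * α)) ^ 2 := by ring
    rw [e, sqrt_sqrt_mul_eq (hx hno) (hx hmo), abs_mul,
      mul_assoc (_ * linfNorm l τ u), div_mul_div_comm, mul_div_assoc', div_mul_eq_mul_div]
    congr 1 <;> ring
  · refine (hmain.trans (mul_sqrt_normRatio_le hB (normRatio_le_of_even hα h hne)
      (normRatio_le_of_not_even hα h hmo))).trans (le_of_eq ?_)
    rw [mixed_parity_bound_eq h.ne _ _ _ _ _ _ (hG h)]
    ring
  · refine (hmain.trans (mul_sqrt_normRatio_le hB (normRatio_le_of_not_even hα h hno)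
      (normRatio_le_of_even hα h hme))).trans (le_of_eq ?_)
    rw [mul_right_comm, mixed_parity_bound_eq h.ne _ _ _ _ _ _ (hG h), mul_comm (m + α)]
    ring
  · refine (hmain.trans (mul_sqrt_normRatio_le hB ((hK n hnK).1 h)
      ((hK m hmK).1 h))).trans (le_of_eq ?_)
    rw [Real.mul_rpow n.cast_nonneg m.cast_nonneg]
    linear_combination constL 4 l * (r : ℝ) ^ 4 * linfNorm l τ u * (n : ℝ) ^ (2 * α) *
      (m : ℝ) ^ (2 * α) * Real.mul_self_sqrt hD.le
  · refine (hmain.trans (mul_sqrt_normRatio_le hB ((hK n hnK).2 h)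
      ((hK m hmK).2 h))).trans (le_of_eq ?_)
    rw [Real.mul_rpow n.cast_nonneg m.cast_nonneg, constD₂]
    linear_combination constL 4 l * (r : ℝ) ^ 4 * linfNorm l τ u * (n : ℝ) ^ α *
      (m : ℝ) ^ α * Real.mul_self_sqrt (by positivity : 0 ≤ A ^ 2 * constD₁ α)
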